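/- Let $G(n,m)$ be the set of $m$-dimensional linear subspaces of $\mathbb{R}^n$, with the metric $\|\pi_V-\pi_W\|$, where $\pi_V:\mathbb{R}^n\to V$ denotes the orthogonal projection onto $V$. Let $G\subset G(n,m)$ be any subset and let $\gamma$ be a finite Borel measure on $G$. Suppose that there is a constant $C$ such that for every unit vector $\xi\in\mathbb{R}^n$ and every $\rho>0$, $$\gamma(\{V\in G: d(\xi,V)\le\rho\})\le C\rho^{\,n-m},$$ where $d(\xi,V)=\inf_{v\in V}|\xi-v|$. Then both parts of the Marstrand–Mattila projection theorem hold for the family $(\pi_V)_{V\in G}$ with respect to $\gamma$, that is, for every Borel set $E\subset\mathbb{R}^n$: 1. (dimension part) if $\dim_H E\le m$, then $\dim_H\pi_V(E)=\dim_H E$ for $\gamma$-almost every $V\in G$; 2. (measure part) if $\dim_H E>m$, then $\pi_V(E)$ has positive $m$-dimensional Lebesgue measure (on $V$) for $\gamma$-almost every $V\in G$. -/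

import Mathlib

open MeasureTheory

noncomputable section

/-- The Grassmannian `G(n, m)` of all `m`-dimensional linear subspaces of `ℝⁿ`. -/
def Grassmann (n m : ℕ) : Type :=
  {V : Submodule ℝ (EuclideanSpace ℝ (Fin n)) // Module.finrank ℝ V = m}

namespace Grassmann

variable {n m : ℕ}

/-- The linear subspace of `ℝⁿ` given by a point of the Grassmannian. -/
def space (V : Grassmann n m) : Submodule ℝ (EuclideanSpace ℝ (Fin n)) := V.1

/-- The orthogonal projection `π_V : ℝⁿ → V`. -/
def proj (V : Grassmann n m) : EuclideanSpace ℝ (Fin n) → V.space :=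
  fun x => V.space.orthogonalProjectionOnto x

/-- The orthogonal projection onto `V`, as an operator of `ℝⁿ` into itself. -/
def projOp (V : Grassmann n m) :
    EuclideanSpace ℝ (Fin n) →L[ℝ] EuclideanSpace ℝ (Fin n) :=
  V.space.starProjection

theorem projOp_injective : Function.Injective (projOp (n := n) (m := m)) := by
  intro V W h
  exact Subtype.ext (Submodule.starProjection_inj.1 h)

/-- The usual metric `d(V, W) = ‖π_V - π_W‖` (operator norm) on the Grassmannian. -/
instance : MetricSpace (Grassmann n m) :=
  MetricSpace.induced projOp projOp_injective inferInstance

/-- The Borel `σ`-algebra of the Grassmannian. -/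
instance : MeasurableSpace (Grassmann n m) := borel _

instance : BorelSpace (Grassmann n m) := ⟨rfl⟩

end Grassmann

/-- Dimension part of the Marstrand–Mattila theorem for the family `(π_V)_{V ∈ G}` and the
measure `γ` on `G`: a Borel set of Hausdorff dimension `s ≤ m` has, for `γ`-almost every `V`,
a projection `π_V(E)` of Hausdorff dimension `s`. Here `γ` is a measure on the Borel sets of
the subspace `G`, which may be an arbitrary subset of the Grassmannian. -/
def MMPDimensionPart {n m : ℕ} (G : Set (Grassmann n m)) (γ : Measure G) : Prop :=
  ∀ E : Set (EuclideanSpace ℝ (Fin n)), MeasurableSet E → dimH E ≤ m →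
    ∀ᵐ V : G ∂γ, dimH (V.1.proj '' E) = dimH E

/-- Measure part of the Marstrand–Mattila theorem: a Borel set of Hausdorff dimension `> m`
has, for `γ`-almost every `V`, a projection `π_V(E)` of positive `m`-dimensional Lebesgue
measure. Here `volume` is the Lebesgue (outer) measure of the `m`-dimensional Euclidean space
`V`, which gives measure one to the unit cube of any orthonormal basis of `V`. -/
def MMPMeasurePart {n m : ℕ} (G : Set (Grassmann n m)) (γ : Measure G) : Prop :=
  ∀ E : Set (EuclideanSpace ℝ (Fin n)), MeasurableSet E → (m : ENNReal) < dimH E →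
    ∀ᵐ V : G ∂γ, 0 < (volume : Measure V.1.space) (V.1.proj '' E)

/-- `((π_V)_{V ∈ G}, γ)` is an MMP space: both parts of the Marstrand–Mattila projection
theorem hold for the restricted family `(π_V)_{V ∈ G}` with respect to `γ`. -/
def IsMMPSpace {n m : ℕ} (G : Set (Grassmann n m)) (γ : Measure G) : Prop :=
  MMPDimensionPart G γ ∧ MMPMeasurePart G γ

end

/-! Put a Frostman measure `μ` on `E` and test its projections with Gaussian energies. Draw `V` from
`γ` and `x` from a standard Gaussian (up to normalisation), and let `ν` be the law of `π_V x`. Its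
Fourier transform at `z` is a multiple of the `γ`-average of `exp (-‖π_V z‖² / 2)`. Hence the
averaged energy `∫∫∫ exp (-‖π_V (x - y)‖² / 2) dμ dμ dγ` is a multiple of `∫ |μ̂|² dν`.

The hypothesis on `γ` controls `ν`. A projection can land in the ball `B(x, r)` only if `V` passes
within `r` of `x`, which has `γ`-measure at most `C (r / ‖x‖) ^ (n - m)`, and then it does so with
mass of order `r ^ m exp (-‖x‖² / 2)`. So `ν` has density at most a constant times `‖x‖ ^ (m - n)
exp (-‖x‖² / 2)`, which is dominated by a sum of Gaussians of widths `2⁻ʲ` and heights `2 ^ (j (n -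
m))` (`projectedGaussian_le_sum`). Transforming back and dilating by `2ᵏ` bounds the averaged energy
at scale `2⁻ᵏ` by a multiple of `∑ⱼ 2 ^ (-j m) ∬ exp (-(2 ^ (k - j) ‖x - y‖)²)`. For a Frostman
exponent `s > t`, with `0 < t ≤ m`, this is `O (2 ^ (-k t))` (`exists_projected_energy_decay`).

For `γ`-almost every `V` such decay controls the projected mass of small balls. If `dim E ≤ m`,
summing over scales and the mass distribution principle give dimension at least every `t < dim E`;
the upper bound holds because projections are Lipschitz. If `dim E > m`, take `t = m`: Fatou's lemma
gives finite lower densities, so the projected measure is absolutely continuous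
(`absolutelyContinuous_of_liminf_lt_top`).

Frostman's lemma for Borel sets (`exists_frostman_measure`) is obtained from a dyadic content that
is continuous from below, a capacitability argument on Baire space, and a weak limit of measures
distributing mass down the dyadic tree. -/

noncomputable section

open Set Filter Topology
open scoped ENNReal NNReal

/-! ### Contents on trees and their continuity from below. -/

section CellContent

variable {X ι : Type*}

/-- The content of `A ⊆ X` for the tree of cells `{x | q k x = z}`: the least weight of a set of
nodes `(k, z)` whose cells cover `A`. -/
def cellContent [MeasurableSpace (ℕ × ι)] (q : ℕ → X → ι) (W : Measure (ℕ × ι)) (A : Set X) :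
    ℝ≥0∞ :=
  ⨅ (U : Set (ℕ × ι)) (_ : ∀ x ∈ A, ∃ k, (k, q k x) ∈ U), W U

theorem code_eq_of_le {q : ℕ → X → ι} (hq : ∀ k x y, q (k + 1) x = q (k + 1) y → q k x = q k y)
    {j k : ℕ} (hjk : j ≤ k) {x y : X} (h : q k x = q k y) : q j x = q j y := by
  induction k, hjk using Nat.le_induction with
  | base => exact h
  | succ k _ ih => exact ih (hq k x y h)

/-- The nodes of `U` that have no node of `U` strictly above them. -/
def maximalNodes (q : ℕ → X → ι) (U : Set (ℕ × ι)) : Set (ℕ × ι) :=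
  {p ∈ U | ∀ x, q p.1 x = p.2 → ∀ k < p.1, (k, q k x) ∉ U}

theorem mem_maximalNodes_of_minimal
    {q : ℕ → X → ι} (hq : ∀ k x y, q (k + 1) x = q (k + 1) y → q k x = q k y)
    {U : Set (ℕ × ι)} {x : X} {k : ℕ}
    (hk : (k, q k x) ∈ U) (hmin : ∀ j < k, (j, q j x) ∉ U) :
    (k, q k x) ∈ maximalNodes q U := by
  refine ⟨hk, fun y hy j hj => ?_⟩
  rw [code_eq_of_le hq hj.le hy]
  exact hmin j hj

theorem exists_mem_maximalNodes
    {q : ℕ → X → ι} (hq : ∀ k x y, q (k + 1) x = q (k + 1) y → q k x = q k y) {U : Set (ℕ × ι)} {x : X}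
    {j : ℕ} (h : (j, q j x) ∈ U) : ∃ k ≤ j, (k, q k x) ∈ maximalNodes q U := by
  classical
  have hex : ∃ k, (k, q k x) ∈ U := ⟨j, h⟩
  exact ⟨Nat.find hex, Nat.find_min' hex h,
    mem_maximalNodes_of_minimal hq (Nat.find_spec hex) fun i hi => Nat.find_min hex hi⟩

variable [MeasurableSpace (ℕ × ι)] {q : ℕ → X → ι} {W : Measure (ℕ × ι)} {A B : Set X}

theorem cellContent_le {U : Set (ℕ × ι)} (h : ∀ x ∈ A, ∃ k, (k, q k x) ∈ U) :
    cellContent q W A ≤ W U :=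
  iInf₂_le U h

theorem exists_cover_of_cellContent_lt {c : ℝ≥0∞} (h : cellContent q W A < c) :
    ∃ U : Set (ℕ × ι), (∀ x ∈ A, ∃ k, (k, q k x) ∈ U) ∧ W U < c := by
  simpa [cellContent, iInf_lt_iff] using h

theorem cellContent_mono (h : A ⊆ B) : cellContent q W A ≤ cellContent q W B :=
  le_iInf₂ fun _ hU => cellContent_le fun x hx => hU x (h hx)

theorem cellContent_empty : cellContent q W ∅ = 0 :=
  le_antisymm ((cellContent_le (U := ∅) (by simp)).trans (by simp)) zero_le

theorem cellContent_cell_le (k : ℕ) (z : ι) :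
    cellContent q W (A ∩ {x | q k x = z}) ≤ W {(k, z)} :=
  cellContent_le fun x hx => ⟨k, by simp [show q k x = z from hx.2]⟩

theorem cellContent_union_le : cellContent q W (A ∪ B) ≤ cellContent q W A + cellContent q W B := by
  refine ENNReal.le_of_forall_pos_le_add fun ε hε hfin => ?_
  have hε2 : (0 : ℝ≥0∞) < ε / 2 := by simpa using hε.ne'
  have h1 := (ENNReal.add_lt_top.1 hfin).1.ne
  have h2 := (ENNReal.add_lt_top.1 hfin).2.ne
  obtain ⟨U, hU, hUW⟩ := exists_cover_of_cellContent_lt (ENNReal.lt_add_right h1 hε2.ne')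
  obtain ⟨V, hV, hVW⟩ := exists_cover_of_cellContent_lt (ENNReal.lt_add_right h2 hε2.ne')
  calc cellContent q W (A ∪ B) ≤ W (U ∪ V) := by
        refine cellContent_le ?_
        rintro x (hx | hx)
        · obtain ⟨k, hk⟩ := hU x hx
          exact ⟨k, Or.inl hk⟩
        · obtain ⟨k, hk⟩ := hV x hx
          exact ⟨k, Or.inr hk⟩
    _ ≤ W U + W V := measure_union_le _ _
    _ ≤ (cellContent q W A + ε / 2) + (cellContent q W B + ε / 2) := by gcongr
    _ = _ := by rw [add_add_add_comm, ENNReal.add_halves]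

theorem cellContent_biUnion_finset_le {κ : Type*} (s : Finset κ) (f : κ → Set X) :
    cellContent q W (⋃ i ∈ s, f i) ≤ ∑ i ∈ s, cellContent q W (f i) := by
  classical
  induction s using Finset.induction_on with
  | empty => simp [cellContent_empty]
  | insert a s ha ih =>
    rw [Finset.sum_insert ha, Finset.set_biUnion_insert]
    exact cellContent_union_le.trans (by gcongr)

/-- A strong subadditivity: two covers can be traded for the maximal nodes of their union plus what
is left over. The leftovers, with the common nodes, still cover `A`, because on each branch the
deeper of the two covering nodes is not maximal. -/
theorem measure_maximalNodes_add_cellContent_le [DiscreteMeasurableSpace (ℕ × ι)]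
    {U V : Set (ℕ × ι)} (hU : ∀ x ∈ A, ∃ k, (k, q k x) ∈ U) (hV : ∀ x ∈ A, ∃ k, (k, q k x) ∈ V) :
    W (maximalNodes q (U ∪ V)) + cellContent q W A ≤ W U + W V := by
  set T := maximalNodes q (U ∪ V)
  have hcov : ∀ x ∈ A, ∃ k, (k, q k x) ∈ ((U ∪ V) \ T) ∪ (U ∩ V) := by
    intro x hx
    obtain ⟨j, hj⟩ := hU x hx
    obtain ⟨k, hk⟩ := hV x hx
    rcases lt_trichotomy j k with h | rfl | h
    · exact ⟨k, Or.inl ⟨Or.inr hk, fun hT => hT.2 x rfl j h (Or.inl hj)⟩⟩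
    · exact ⟨j, Or.inr ⟨hj, hk⟩⟩
    · exact ⟨j, Or.inl ⟨Or.inl hj, fun hT => hT.2 x rfl k h (Or.inr hk)⟩⟩
  have hTsub : T ⊆ U ∪ V := fun p hp => hp.1
  calc W T + cellContent q W A ≤ W T + (W ((U ∪ V) \ T) + W (U ∩ V)) := by
        gcongr
        exact (cellContent_le hcov).trans (measure_union_le _ _)
    _ = W (U ∪ V) + W (U ∩ V) := by
        rw [← add_assoc, ← measure_union disjoint_sdiff_right (MeasurableSet.of_discrete),
          union_sdiff_cancel hTsub]
    _ = W U + W V := measure_union_add_inter _ (MeasurableSet.of_discrete)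

/-- The content of an increasing union is the limit of the contents. -/
theorem cellContent_iUnion_le [DiscreteMeasurableSpace (ℕ × ι)]
    (hq : ∀ k x y, q (k + 1) x = q (k + 1) y → q k x = q k y) {A : ℕ → Set X} (hA : Monotone A)
    {c : ℝ≥0∞} (hc : ∀ n, cellContent q W (A n) ≤ c) : cellContent q W (⋃ n, A n) ≤ c := by
  rcases eq_or_ne c ∞ with rfl | hctop
  · exact le_top
  have hfin : ∀ n, cellContent q W (A n) ≠ ∞ := fun n => ((hc n).trans_lt hctop.lt_top).ne
  refine ENNReal.le_of_forall_pos_le_add fun ε hε _ => ?_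
  obtain ⟨δ, hδ, hδsum⟩ := ENNReal.exists_pos_sum_of_countable' (ε := (ε : ℝ≥0∞))
    (by simpa using hε.ne') ℕ
  have hcover : ∀ n, ∃ U : Set (ℕ × ι), (∀ x ∈ A n, ∃ k, (k, q k x) ∈ U) ∧
      W U < cellContent q W (A n) + δ n := fun n =>
    exists_cover_of_cellContent_lt (ENNReal.lt_add_right (hfin n) (hδ n).ne')
  choose U hU hUW using hcover
  -- Merging near-optimal covers and keeping only maximal nodes makes the covering node of each
  -- point move only upwards, while the errors `δ` merely add up.
  let V : ℕ → Set (ℕ × ι) := fun n => Nat.rec (U 0) (fun n V => maximalNodes q (V ∪ U (n + 1))) n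
  have hVs : ∀ n, V (n + 1) = maximalNodes q (V n ∪ U (n + 1)) := fun n => rfl
  have hVdesc : ∀ n x j, (j, q j x) ∈ V n → ∃ k ≤ j, (k, q k x) ∈ V (n + 1) := by
    intro n x j hj
    rw [hVs]
    exact exists_mem_maximalNodes hq (Or.inl hj)
  have hVcov : ∀ n, ∀ x ∈ A n, ∃ k, (k, q k x) ∈ V n := by
    intro n
    cases n with
    | zero => exact hU 0
    | succ n =>
      intro x hx
      obtain ⟨j, hj⟩ := hU _ x hx
      obtain ⟨k, -, hk⟩ := exists_mem_maximalNodes hq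
        (U := V n ∪ U (n + 1)) (Or.inr hj)
      exact ⟨k, hk⟩
  have hVW : ∀ n, W (V n) ≤ cellContent q W (A n) + ∑ i ∈ Finset.range (n + 1), δ i := by
    intro n
    induction n with
    | zero => simpa [V] using (hUW 0).le
    | succ n ih =>
      -- Both `V n` and `U (n + 1)` cover `A n`; the finite content of `A n` is cancelled at the
      -- end.
      have h1 := measure_maximalNodes_add_cellContent_le (W := W) (hVcov n)
        fun x hx => hU (n + 1) x (hA n.le_succ hx)
      rw [← hVs] at h1
      have h2 : W (V (n + 1)) + cellContent q W (A n) ≤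
          (cellContent q W (A (n + 1)) + ∑ i ∈ Finset.range (n + 2), δ i) +
            cellContent q W (A n) := by
        refine h1.trans ((add_le_add ih (hUW (n + 1)).le).trans_eq ?_)
        rw [Finset.sum_range_succ _ (n + 1)]
        ring
      exact (ENNReal.add_le_add_iff_right (hfin n)).1 h2
  have hVle : ∀ n, W (V n) ≤ c + ε := fun n =>
    (hVW n).trans (add_le_add (hc n) ((ENNReal.sum_le_tsum _).trans hδsum.le))
  -- The union of the `L N` is the set of nodes lying in all but finitely many `V n`; it is the
  -- cover of the whole union.
  let L : ℕ → Set (ℕ × ι) := fun N => ⋂ n ≥ N, V n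
  have hLmono : Monotone L := fun M N hMN =>
    biInter_subset_biInter_left fun n (hn : N ≤ n) => hMN.trans hn
  have hLW : W (⋃ N, L N) ≤ c + ε := by
    rw [hLmono.measure_iUnion]
    exact iSup_le fun N => (measure_mono (biInter_subset_of_mem (le_refl N))).trans (hVle N)
  refine (cellContent_le fun x hx => ?_).trans hLW
  obtain ⟨N, hN⟩ := mem_iUnion.1 hx
  have hex : ∀ n, {k | (k, q k x) ∈ V (N + n)}.Nonempty := fun n =>
    hVcov _ x (hA (Nat.le_add_right N n) hN)
  -- The level of the topmost node of `V (N + n)` above `x` decreases with `n`, hence stabilises,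
  -- and the stable node lies in some `L`.
  let lev : ℕ → ℕ := fun n => sInf {k | (k, q k x) ∈ V (N + n)}
  have hlevmem : ∀ n, (lev n, q (lev n) x) ∈ V (N + n) := fun n => Nat.sInf_mem (hex n)
  have hlev : Antitone lev := antitone_nat_of_succ_le fun n => by
    obtain ⟨k, hk, hkV⟩ := hVdesc (N + n) x _ (hlevmem n)
    exact (Nat.sInf_le (s := {k | (k, q k x) ∈ V (N + (n + 1))}) hkV).trans hk
  obtain ⟨n0, hn0⟩ : ∃ n0, ∀ n ≥ n0, lev n = lev n0 := by
    obtain ⟨n0, hn0⟩ := WellFounded.has_min (wellFounded_lt (α := ℕ)) (range lev) ⟨_, 0, rfl⟩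
    obtain ⟨⟨n1, rfl⟩, h⟩ := hn0
    exact ⟨n1, fun n hn => le_antisymm (hlev hn) (not_lt.1 (h _ ⟨n, rfl⟩))⟩
  refine ⟨lev n0, mem_iUnion.2 ⟨N + n0, mem_iInter₂.2 fun n hn => ?_⟩⟩
  obtain ⟨i, rfl⟩ : ∃ i, n = N + i := ⟨n - N, by omega⟩
  rw [← hn0 i (by omega)]
  exact hlevmem i

theorem exists_le_cellContent_of_iUnion [DiscreteMeasurableSpace (ℕ × ι)]
    (hq : ∀ k x y, q (k + 1) x = q (k + 1) y → q k x = q k y) {A : ℕ → Set X} (hA : Monotone A)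
    {c : ℝ≥0∞} (hc : c < cellContent q W (⋃ n, A n)) : ∃ n, c < cellContent q W (A n) := by
  by_contra! h
  exact (cellContent_iUnion_le hq hA h).not_gt hc

end CellContent

/-! ### Capacitability on Baire space. -/

section Capacitability

/-- The points of Baire space whose coordinates of index `< k` are bounded by `N`. -/
def baireBox (N : ℕ → ℕ) (k : ℕ) : Set (ℕ → ℕ) := {x | ∀ i < k, x i ≤ N i}

theorem baireBox_congr {N N' : ℕ → ℕ} {k : ℕ} (h : ∀ i < k, N i = N' i) :
    baireBox N k = baireBox N' k := by
  ext x
  exact forall₂_congr fun i hi => by rw [h i hi]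

theorem isCompact_iInter_baireBox (N : ℕ → ℕ) : IsCompact (⋂ k, baireBox N k) := by
  have : ⋂ k, baireBox N k = Set.pi univ fun i => Iic (N i) := by
    ext x
    simp only [baireBox, mem_iInter, mem_ofPred_eq, Set.mem_pi, mem_univ, true_implies, mem_Iic]
    exact ⟨fun h i => h (i + 1) i i.lt_succ_self, fun h k i _ => h i⟩
  rw [this]
  exact isCompact_univ_pi fun i => (finite_Iic (N i)).isCompact

/-- A box restricts finitely many coordinates and is not compact, but truncating a point of the
`k`-th box changes only coordinates of index at least `k`, so limits can be taken in the compact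
product. -/
theorem exists_baireBox_subset_of_isOpen (N : ℕ → ℕ) {U : Set (ℕ → ℕ)} (hU : IsOpen U)
    (h : ⋂ k, baireBox N k ⊆ U) : ∃ k, baireBox N k ⊆ U := by
  by_contra! hcon
  have hx : ∀ k, ∃ x ∈ baireBox N k, x ∉ U := fun k => not_subset.1 (hcon k)
  choose x hxB hxU using hx
  -- truncate the points so that they lie in the compact set
  let y : ℕ → ℕ → ℕ := fun k i => min (x k i) (N i)
  have hy : ∀ k, y k ∈ ⋂ k, baireBox N k := fun k =>
    mem_iInter.2 fun _ i _ => min_le_right _ _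
  obtain ⟨a, ha, φ, hφ, hlim⟩ := (isCompact_iInter_baireBox N).tendsto_subseq hy
  have hlim' : Tendsto (x ∘ φ) atTop (𝓝 a) := by
    rw [tendsto_pi_nhds] at hlim ⊢
    intro i
    refine (hlim i).congr' ?_
    filter_upwards [eventually_gt_atTop i] with k hk
    exact min_eq_left (hxB (φ k) i (hk.trans_le (hφ.id_le k)))
  obtain ⟨k, hk⟩ := (hlim'.eventually (hU.mem_nhds (h ha))).exists
  exact hxU _ hk

/-- **Capacitability**: a set function that is monotone and continuous from below is
approximated on continuous images of Baire space by decreasing sets shrinking to a compact set. -/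
theorem exists_baireBox_lt {X : Type*} (M : Set X → ℝ≥0∞)
    (hM : ∀ A : ℕ → Set X, Monotone A → ∀ c, c < M (⋃ n, A n) → ∃ n, c < M (A n))
    (f : (ℕ → ℕ) → X) {c : ℝ≥0∞} (hc : c < M (range f)) :
    ∃ N : ℕ → ℕ, ∀ k, c < M (f '' baireBox N k) := by
  have step : ∀ (k : ℕ) (N : ℕ → ℕ), c < M (f '' baireBox N k) →
      ∃ b, c < M (f '' baireBox (Function.update N k b) (k + 1)) := by
    intro k N h
    refine hM (fun b => f '' baireBox (Function.update N k b) (k + 1)) ?_ c ?_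
    · intro b b' hbb'
      refine image_mono fun x hx i hi => (hx i hi).trans ?_
      rcases eq_or_ne i k with rfl | hik
      · simpa using hbb'
      · simp [hik]
    · refine h.trans_eq (congrArg M ?_)
      rw [← image_iUnion]
      congr 1
      ext x
      simp only [mem_iUnion]
      constructor
      · intro hx
        refine ⟨x k, fun i hi => ?_⟩
        rcases eq_or_ne i k with rfl | hik
        · simp
        · simpa [hik] using hx i (by omega)
      · rintro ⟨b, hx⟩ i hi
        simpa [hi.ne] using hx i (by omega)
  choose! b hb using step
  -- The bounds are chosen one coordinate at a time; coordinate `i` is frozen from stage `i + 1` on,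
  -- so the diagonal gives the final sequence.
  let S : ℕ → ℕ → ℕ := fun k => Nat.rec (fun _ => 0) (fun k N => Function.update N k (b k N)) k
  have hSs : ∀ k, S (k + 1) = Function.update (S k) k (b k (S k)) := fun k => rfl
  have hS : ∀ k, c < M (f '' baireBox (S k) k) := by
    intro k
    induction k with
    | zero => simpa [baireBox, image_univ] using hc
    | succ k ih => exact hb k _ ih
  have hstab : ∀ k i, i < k → S k i = S (i + 1) i := by
    intro k i hik
    induction k, hik using Nat.le_induction with
    | base => rfl
    | succ k hk ih => rw [hSs, Function.update_of_ne (by omega), ih]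
  refine ⟨fun i => S (i + 1) i, fun k => ?_⟩
  rw [← baireBox_congr (hstab k)]
  exact hS k

/-- A point outside the compact image of the intersection of the boxes is separated from it by open
sets, and one of them already contains the image of some box. -/
theorem iInter_closure_image_baireBox_subset {X : Type*} [TopologicalSpace X] [T2Space X]
    [RegularSpace X] {f : (ℕ → ℕ) → X} (hf : Continuous f) (N : ℕ → ℕ) :
    ⋂ k, closure (f '' baireBox N k) ⊆ range f := by
  intro y hy
  by_contra hyr
  have hK : IsCompact (f '' ⋂ k, baireBox N k) := (isCompact_iInter_baireBox N).image hf
  have hyK : y ∉ f '' ⋂ k, baireBox N k := fun h => hyr (image_subset_range _ _ h)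
  obtain ⟨U, V, hU, hV, hKU, hyV, hUV⟩ :=
    SeparatedNhds.of_isCompact_isCompact hK isCompact_singleton (disjoint_singleton_right.2 hyK)
  obtain ⟨k, hk⟩ := exists_baireBox_subset_of_isOpen N (hU.preimage hf) (image_subset_iff.1 hKU)
  have h1 : closure (f '' baireBox N k) ⊆ Vᶜ :=
    closure_minimal ((image_subset_iff.2 hk).trans hUV.subset_compl_right) hV.isClosed_compl
  exact h1 (mem_iInter.1 hy k) (hyV rfl)

end Capacitability

/-! ### Distributing mass down a tree. -/

section MassDistribution

variable {X ι : Type*} [MeasurableSpace (ℕ × ι)] {q : ℕ → X → ι} {W : Measure (ℕ × ι)} {A : Set X}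

/-- Subadditivity over the children of a cell: the children have room for all the mass that the
parent is allowed. -/
theorem cellContent_inter_cell_le_sum [DecidableEq ι] {k : ℕ} {p : ι} {Z : Finset ι} {x : ι → X}
    (hq : ∀ k x y, q (k + 1) x = q (k + 1) y → q k x = q k y)
    (hZ : ∀ y ∈ A, q (k + 1) y ∈ Z) (hx : ∀ z ∈ Z, q (k + 1) (x z) = z) :
    cellContent q W (A ∩ {y | q k y = p}) ≤
      ∑ z ∈ Z with q k (x z) = p, cellContent q W (A ∩ {y | q (k + 1) y = z}) := by
  refine (cellContent_mono ?_).trans (cellContent_biUnion_finset_le _ _)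
  rintro y ⟨hyA, hyp⟩
  have hz := hZ y hyA
  refine mem_iUnion₂.2 ⟨q (k + 1) y, Finset.mem_filter.2 ⟨hz, ?_⟩, hyA, rfl⟩
  rw [hq k _ _ (hx _ hz)]
  exact hyp

variable [MeasurableSpace X] [MeasurableSpace ι] [Countable ι] [DiscreteMeasurableSpace ι]

/-- One step of the mass distribution: the mass of each cell of level `k` is distributed among
its subcells proportionally to the content of their intersections with `A`. -/
theorem exists_measure_refine
    (hq : ∀ k x y, q (k + 1) x = q (k + 1) y → q k x = q k y) (hqm : ∀ k, Measurable (q k))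
    (hA : ∀ k, (q k '' A).Finite) (hW : ∀ p, W {p} ≠ ∞) (k : ℕ) (μ : Measure X)
    (hμA : ∀ p, μ {x | q k x = p} ≤ cellContent q W (A ∩ {x | q k x = p})) :
    ∃ ν : Measure X, (∀ B, MeasurableSet B → A ⊆ B → ν Bᶜ = 0) ∧
      ν.map (q k) = μ.map (q k) ∧
      ∀ z, ν {x | q (k + 1) x = z} ≤ cellContent q W (A ∩ {x | q (k + 1) x = z}) := by
  classical
  set Z : Finset ι := (hA (k + 1)).toFinset with hZdef
  have hZmem : ∀ y ∈ A, q (k + 1) y ∈ Z := fun y hy =>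
    (hA (k + 1)).mem_toFinset.2 (mem_image_of_mem _ hy)
  have hex : ∀ z ∈ Z, ∃ x ∈ A, q (k + 1) x = z := fun z hz => (hA (k + 1)).mem_toFinset.1 hz
  rcases A.eq_empty_or_nonempty with rfl | ⟨a0, ha0⟩
  · have hμ0 : μ.map (q k) = 0 := by
      refine Measure.ext_of_singleton fun p => ?_
      rw [Measure.map_apply (hqm k) (measurableSet_singleton p)]
      have h := hμA p
      rw [empty_inter, cellContent_empty] at h
      exact nonpos_iff_eq_zero.1 h
    exact ⟨0, by simp, by rw [hμ0, Measure.map_zero], by simp⟩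
  have : Nonempty X := ⟨a0⟩
  choose! x hxA hxz using hex
  set f : ι → ℝ≥0∞ := fun z => cellContent q W (A ∩ {y | q (k + 1) y = z}) with hf
  have hffin : ∀ z, f z ≠ ∞ := fun z => ((cellContent_cell_le (k + 1) z).trans_lt
    (hW (k + 1, z)).lt_top).ne
  set S : ι → ℝ≥0∞ := fun p => ∑ z ∈ Z with q k (x z) = p, f z with hS
  have hSfin : ∀ p, S p ≠ ∞ := fun p => ENNReal.sum_ne_top.2 fun z _ => hffin z
  have hμS : ∀ p, μ {y | q k y = p} ≤ S p := fun p =>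
    (hμA p).trans (cellContent_inter_cell_le_sum hq hZmem hxz)
  -- The factor of `f z` is at most one by `hμS`. Where the denominator vanishes the parent cell has
  -- no mass, so the division by zero is harmless.
  set a : ι → ℝ≥0∞ := fun z => μ {y | q k y = q k (x z)} / S (q k (x z)) * f z with ha
  set ν : Measure X := ∑ z ∈ Z, a z • Measure.dirac (x z) with hν
  have hcell : ∀ k p, MeasurableSet {y | q k y = p} := fun k p =>
    hqm k (measurableSet_singleton p)
  have hνapply : ∀ j p, ν {y | q j y = p} = ∑ z ∈ Z with q j (x z) = p, a z := by
    intro j p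
    rw [hν, Measure.finsetSum_apply, Finset.sum_filter]
    refine Finset.sum_congr rfl fun z _ => ?_
    rw [Measure.smul_apply, Measure.dirac_apply' _ (hcell j p), smul_eq_mul, indicator_apply]
    simp
  refine ⟨ν, fun B hB hAB => ?_, ?_, fun z => ?_⟩
  · rw [hν, Measure.finsetSum_apply]
    refine Finset.sum_eq_zero fun z hz => ?_
    rw [Measure.smul_apply, Measure.dirac_apply' _ hB.compl]
    simp [hAB (hxA z hz)]
  · refine Measure.ext_of_singleton fun p => ?_
    rw [Measure.map_apply (hqm k) (measurableSet_singleton p),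
      Measure.map_apply (hqm k) (measurableSet_singleton p)]
    change ν {y | q k y = p} = μ {y | q k y = p}
    rw [hνapply]
    have h1 : ∑ z ∈ Z with q k (x z) = p, a z = μ {y | q k y = p} / S p * S p := by
      rw [hS, Finset.mul_sum]
      refine Finset.sum_congr rfl fun z hz => ?_
      simp only [ha, hS, (Finset.mem_filter.1 hz).2]
    rw [h1]
    rcases eq_or_ne (S p) 0 with h0 | h0
    · rw [h0, mul_zero]
      exact (nonpos_iff_eq_zero.1 ((hμS p).trans_eq h0)).symm
    · exact ENNReal.div_mul_cancel h0 (hSfin p)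
  · rw [hνapply]
    calc ∑ z' ∈ Z with q (k + 1) (x z') = z, a z' ≤ ∑ z' ∈ {z}, a z' := by
          refine Finset.sum_le_sum_of_subset fun z' hz' => ?_
          rw [Finset.mem_filter] at hz'
          rw [Finset.mem_singleton, ← hxz z' hz'.1, hz'.2]
      _ = a z := Finset.sum_singleton _ _
      _ ≤ 1 * f z := by
          refine mul_le_mul_left ?_ _
          exact ENNReal.div_le_of_le_mul (by simpa using hμS _)
      _ = _ := one_mul _

/-- **Mass distribution on a tree**: a set of content `≥ c` carries, for each level `k`, a measure
of mass `≥ c` giving each cell of level `≤ k` at most its weight. -/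
theorem exists_measure_cell_le
    (hq : ∀ k x y, q (k + 1) x = q (k + 1) y → q k x = q k y) (hqm : ∀ k, Measurable (q k))
    (hA : ∀ k, (q k '' A).Finite) (hW : ∀ p, W {p} ≠ ∞) (k : ℕ) :
    ∃ μ : Measure X, (∀ B, MeasurableSet B → A ⊆ B → μ Bᶜ = 0) ∧
      cellContent q W A ≤ μ univ ∧ μ univ ≠ ∞ ∧ ∀ j ≤ k, ∀ z, μ {x | q j x = z} ≤ W {(j, z)} := by
  classical
  -- The induction needs the sharper bound by content at the last level; the bound by weight alone
  -- would not say how much mass the children can receive.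
  suffices h : ∃ μ : Measure X, (∀ B, MeasurableSet B → A ⊆ B → μ Bᶜ = 0) ∧
      cellContent q W A ≤ μ univ ∧ μ univ ≠ ∞ ∧ (∀ j ≤ k, ∀ z, μ {x | q j x = z} ≤ W {(j, z)}) ∧
      ∀ z, μ {x | q k x = z} ≤ cellContent q W (A ∩ {x | q k x = z}) by
    obtain ⟨μ, h1, h2, h3, h4, -⟩ := h
    exact ⟨μ, h1, h2, h3, h4⟩
  have hcell : ∀ k p, MeasurableSet {y | q k y = p} := fun k p =>
    hqm k (measurableSet_singleton p)
  induction k with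
  | zero =>
    set Z : Finset ι := (hA 0).toFinset with hZdef
    have hex : ∀ z ∈ Z, ∃ x ∈ A, q 0 x = z := fun z hz => (hA 0).mem_toFinset.1 hz
    rcases A.eq_empty_or_nonempty with rfl | ⟨a0, ha0⟩
    · exact ⟨0, by simp, by simp [cellContent_empty], by simp, by simp, by simp⟩
    have : Nonempty X := ⟨a0⟩
    choose! x hxA hxz using hex
    set f : ι → ℝ≥0∞ := fun z => cellContent q W (A ∩ {y | q 0 y = z}) with hf
    have hffin : ∀ z, f z ≠ ∞ := fun z => ((cellContent_cell_le 0 z).trans_lt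
      (hW (0, z)).lt_top).ne
    set ν : Measure X := ∑ z ∈ Z, f z • Measure.dirac (x z) with hν
    have hνuniv : ν univ = ∑ z ∈ Z, f z := by
      rw [hν, Measure.finsetSum_apply]
      simp
    have hνcell : ∀ p, ν {y | q 0 y = p} ≤ f p := by
      intro p
      calc ν {y | q 0 y = p} = ∑ z ∈ Z with q 0 (x z) = p, f z := by
            rw [hν, Measure.finsetSum_apply, Finset.sum_filter]
            refine Finset.sum_congr rfl fun z _ => ?_
            rw [Measure.smul_apply, Measure.dirac_apply' _ (hcell 0 p), smul_eq_mul,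
              indicator_apply]
            simp
        _ ≤ ∑ z ∈ {p}, f z := by
            refine Finset.sum_le_sum_of_subset fun z' hz' => ?_
            rw [Finset.mem_filter] at hz'
            rw [Finset.mem_singleton, ← hxz z' hz'.1, hz'.2]
        _ = f p := Finset.sum_singleton _ _
    refine ⟨ν, fun B hB hAB => ?_, ?_, ?_, fun j hj z => ?_, hνcell⟩
    · rw [hν, Measure.finsetSum_apply]
      refine Finset.sum_eq_zero fun z hz => ?_
      rw [Measure.smul_apply, Measure.dirac_apply' _ hB.compl]
      simp [hAB (hxA z hz)]
    · rw [hνuniv]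
      refine (cellContent_mono fun y hy => ?_).trans (cellContent_biUnion_finset_le Z _)
      exact mem_iUnion₂.2 ⟨q 0 y, (hA 0).mem_toFinset.2 (mem_image_of_mem _ hy), hy, rfl⟩
    · rw [hνuniv]
      exact ENNReal.sum_ne_top.2 fun z _ => hffin z
    · obtain rfl : j = 0 := by omega
      exact (hνcell z).trans (cellContent_cell_le 0 z)
  | succ k ih =>
    obtain ⟨μ, -, hμc, hμfin, hμW, hμk⟩ := ih
    obtain ⟨ν, hνA, hνμ, hνk⟩ := exists_measure_refine hq hqm hA hW k μ hμk
    have huniv : ν univ = μ univ := by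
      have h := congrArg (fun m => m univ) hνμ
      simpa [Measure.map_apply (hqm k) MeasurableSet.univ] using h
    refine ⟨ν, hνA, huniv ▸ hμc, huniv ▸ hμfin, fun j hj z => ?_, hνk⟩
    rcases hj.lt_or_eq with hjk | rfl
    · have hjk' : j ≤ k := by omega
      -- A cell of level `j ≤ k` is a union of cells of level `k`, whose masses the refinement
      -- preserves.
      have hset : {x | q j x = z} = q k ⁻¹' (q k '' {x | q j x = z}) := by
        refine Subset.antisymm (subset_preimage_image _ _) ?_
        rintro x ⟨y, hy, hyx⟩
        exact (code_eq_of_le hq hjk' hyx).symm.trans hy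
      rw [hset, ← Measure.map_apply (hqm k) MeasurableSet.of_discrete, hνμ,
        Measure.map_apply (hqm k) MeasurableSet.of_discrete, ← hset]
      exact hμW j hjk' z
    · exact (hνk z).trans (cellContent_cell_le _ z)

end MassDistribution

/-! ### Dyadic cubes and Hausdorff measure. -/

section Dyadic

variable {n : ℕ}

/-- The index of the half-open dyadic cube of side `2⁻ᵏ` containing `x`. -/
def dyadicCode (k : ℕ) (x : EuclideanSpace ℝ (Fin n)) : Fin n → ℤ := fun i => ⌊2 ^ k * x i⌋

theorem dyadicCode_of_succ (k : ℕ) (x y : EuclideanSpace ℝ (Fin n))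
    (h : dyadicCode (k + 1) x = dyadicCode (k + 1) y) : dyadicCode k x = dyadicCode k y := by
  have key : ∀ a : ℝ, ⌊2 ^ k * a⌋ = ⌊2 ^ (k + 1) * a⌋ / 2 := fun a => by
    have h := Int.floor_div_natCast (2 ^ (k + 1) * a) 2
    rw [show 2 ^ k * a = 2 ^ (k + 1) * a / (2 : ℕ) by push_cast; ring, h]
    rfl
  funext i
  have hi := congrFun h i
  simp only [dyadicCode] at hi ⊢
  rw [key, key, hi]

theorem measurable_dyadicCode (k : ℕ) :
    Measurable (dyadicCode k : EuclideanSpace ℝ (Fin n) → Fin n → ℤ) := by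
  refine measurable_pi_lambda _ fun i => ?_
  have : Measurable fun x : EuclideanSpace ℝ (Fin n) => 2 ^ k * x i := by fun_prop
  exact Int.measurable_floor.comp this

theorem abs_sub_lt_of_floor_eq {k : ℕ} {a b : ℝ} (h : ⌊2 ^ k * a⌋ = ⌊2 ^ k * b⌋) :
    |a - b| < (2 ^ k)⁻¹ := by
  have h1 := Int.abs_sub_lt_one_of_floor_eq_floor h
  have h2 : (0 : ℝ) < 2 ^ k := by positivity
  rw [← mul_sub, abs_mul, abs_of_pos h2] at h1
  rw [← one_div, lt_div_iff₀ h2, mul_comm]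
  exact h1

theorem finite_dyadicCode_image (k : ℕ) {A : Set (EuclideanSpace ℝ (Fin n))}
    (hA : Bornology.IsBounded A) : (dyadicCode k '' A).Finite := by
  obtain ⟨R, hR⟩ := hA.exists_norm_le
  refine (Set.Finite.pi' fun _ : Fin n => Set.finite_Icc ⌊2 ^ k * (-R)⌋ ⌊2 ^ k * R⌋).subset ?_
  rintro _ ⟨x, hx, rfl⟩ i
  have hxi : |x i| ≤ R := (Real.norm_eq_abs _ ▸ PiLp.norm_apply_le x i).trans (hR x hx)
  rw [abs_le] at hxi
  constructor <;> refine Int.floor_le_floor ?_ <;> gcongr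
  exacts [hxi.1, hxi.2]

theorem dist_le_of_dyadicCode_eq {k : ℕ} {x y : EuclideanSpace ℝ (Fin n)}
    (h : dyadicCode k x = dyadicCode k y) : dist x y ≤ √n * (2 ^ k)⁻¹ := by
  rw [EuclideanSpace.dist_eq]
  calc √(∑ i, dist (x i) (y i) ^ 2) ≤ √(∑ _i : Fin n, ((2 ^ k)⁻¹ : ℝ) ^ 2) := by
        refine Real.sqrt_le_sqrt (Finset.sum_le_sum fun i _ => ?_)
        rw [Real.dist_eq]
        gcongr
        exact (abs_sub_lt_of_floor_eq (congrFun h i)).le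
    _ = √n * (2 ^ k)⁻¹ := by
        rw [Finset.sum_const, Finset.card_univ, Fintype.card_fin, nsmul_eq_mul, Real.sqrt_mul
          (Nat.cast_nonneg n), Real.sqrt_sq (by positivity)]

/-- The indices of the dyadic cubes of level `k` adjacent to that of `x`. -/
def dyadicNeighbors (k : ℕ) (x : EuclideanSpace ℝ (Fin n)) : Finset (Fin n → ℤ) :=
  Fintype.piFinset fun i => Finset.Icc (dyadicCode k x i - 1) (dyadicCode k x i + 1)

theorem card_dyadicNeighbors (k : ℕ) (x : EuclideanSpace ℝ (Fin n)) :
    (dyadicNeighbors k x).card = 3 ^ n := by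
  rw [dyadicNeighbors, Fintype.card_piFinset]
  have h : ∀ z : ℤ, (z + 1 + 1 - (z - 1)).toNat = 3 := fun z => by omega
  simp [Int.card_Icc, h]

theorem dyadicCode_mem_dyadicNeighbors {k : ℕ} {x y : EuclideanSpace ℝ (Fin n)}
    (h : dist y x ≤ (2 ^ k)⁻¹) : dyadicCode k y ∈ dyadicNeighbors k x := by
  rw [dyadicNeighbors, Fintype.mem_piFinset]
  intro i
  have h1 : |y i - x i| ≤ (2 ^ k)⁻¹ := by
    have := PiLp.norm_apply_le (y - x) i
    rw [PiLp.sub_apply, Real.norm_eq_abs, ← dist_eq_norm] at this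
    exact this.trans h
  have h2 : (0 : ℝ) < 2 ^ k := by positivity
  have h3 : 2 ^ k * |y i - x i| ≤ 1 := by
    calc 2 ^ k * |y i - x i| ≤ 2 ^ k * (2 ^ k)⁻¹ := by gcongr
      _ = 1 := mul_inv_cancel₀ h2.ne'
  rw [← abs_of_pos h2, ← abs_mul, mul_sub, abs_le] at h3
  simp only [dyadicCode, Finset.mem_Icc]
  constructor
  · rw [← Int.floor_sub_one]
    exact Int.floor_le_floor (by linarith [h3.1])
  · rw [← Int.floor_add_one]
    exact Int.floor_le_floor (by linarith [h3.2])

/-- The weight `2⁻ᵏˢ` on dyadic cubes of side `2⁻ᵏ`. -/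
def dyadicWeight (n : ℕ) (s : ℝ≥0) : Measure (ℕ × (Fin n → ℤ)) :=
  Measure.count.withDensity fun p => ((2 : ℝ≥0∞)⁻¹ ^ p.1) ^ (s : ℝ)

theorem dyadicWeight_apply (s : ℝ≥0) (U : Set (ℕ × (Fin n → ℤ))) :
    dyadicWeight n s U = ∑' p : U, ((2 : ℝ≥0∞)⁻¹ ^ p.1.1) ^ (s : ℝ) := by
  rw [dyadicWeight, withDensity_apply _ MeasurableSet.of_discrete,
    ← lintegral_indicator MeasurableSet.of_discrete, lintegral_count,
    tsum_subtype U fun p : ℕ × (Fin n → ℤ) => ((2 : ℝ≥0∞)⁻¹ ^ p.1) ^ (s : ℝ)]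

theorem dyadicWeight_singleton (s : ℝ≥0) (p : ℕ × (Fin n → ℤ)) :
    dyadicWeight n s {p} = ((2 : ℝ≥0∞)⁻¹ ^ p.1) ^ (s : ℝ) := by
  rw [dyadicWeight_apply, tsum_singleton p fun p => ((2 : ℝ≥0∞)⁻¹ ^ p.1) ^ (s : ℝ)]

theorem inv_two_pow_rpow_ne_top (k : ℕ) (s : ℝ≥0) : ((2 : ℝ≥0∞)⁻¹ ^ k) ^ (s : ℝ) ≠ ∞ :=
  ENNReal.rpow_ne_top_of_nonneg s.2 (ENNReal.pow_ne_top (by simp))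

/-- A cover of tiny total weight uses only small cubes, since for `s > 0` a single large cube would
already weigh too much. So the content, though it imposes no bound on the size of the cubes, has no
fewer null sets than `μH[s]`. -/
theorem hausdorffMeasure_eq_zero_of_cellContent_eq_zero {s : ℝ≥0} (hs : 0 < s)
    {A : Set (EuclideanSpace ℝ (Fin n))}
    (hA : cellContent dyadicCode (dyadicWeight n s) A = 0) : μH[s] A = 0 := by
  have hpos : ∀ N : ℕ, 0 < ((2 : ℝ≥0∞)⁻¹ ^ N) ^ (s : ℝ) := fun N =>
    ENNReal.rpow_pos (ENNReal.pow_pos (by simp) N) (ENNReal.pow_ne_top (by simp))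
  have hex : ∀ N : ℕ, ∃ U : Set (ℕ × (Fin n → ℤ)), (∀ x ∈ A, ∃ k, (k, dyadicCode k x) ∈ U) ∧
      dyadicWeight n s U < ((2 : ℝ≥0∞)⁻¹ ^ N) ^ (s : ℝ) := fun N =>
    exists_cover_of_cellContent_lt (hA ▸ hpos N)
  choose U hU hUW using hex
  have hs' : (0 : ℝ) < s := hs
  have hlim : Tendsto (fun N : ℕ => (2 : ℝ≥0∞)⁻¹ ^ N) atTop (𝓝 0) :=
    ENNReal.tendsto_pow_atTop_nhds_zero_of_lt_one (by simp)
  have hediam : ∀ p : ℕ × (Fin n → ℤ),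
      Metric.ediam {x : EuclideanSpace ℝ (Fin n) | dyadicCode p.1 x = p.2} ≤
        ENNReal.ofReal √n * (2 : ℝ≥0∞)⁻¹ ^ p.1 := by
    intro p
    refine Metric.ediam_le fun x hx y hy => ?_
    rw [edist_dist]
    refine (ENNReal.ofReal_le_ofReal (dist_le_of_dyadicCode_eq (hx.trans hy.symm))).trans_eq ?_
    rw [ENNReal.ofReal_mul (Real.sqrt_nonneg _), ENNReal.ofReal_inv_of_pos (by positivity),
      ENNReal.ofReal_pow zero_le_two, ENNReal.ofReal_ofNat, ENNReal.inv_pow]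
  have hlevel : ∀ N, ∀ p ∈ U N, (2 : ℝ≥0∞)⁻¹ ^ p.1 ≤ 2⁻¹ ^ N := by
    intro N p hp
    have h1 : ((2 : ℝ≥0∞)⁻¹ ^ p.1) ^ (s : ℝ) < (2⁻¹ ^ N) ^ (s : ℝ) := by
      rw [← dyadicWeight_singleton s p]
      exact (measure_mono (singleton_subset_iff.2 hp)).trans_lt (hUW N)
    exact ((ENNReal.rpow_lt_rpow_iff hs').1 h1).le
  have hD : ENNReal.ofReal √n ≠ ∞ := ENNReal.ofReal_ne_top
  have hle := Measure.hausdorffMeasure_le_liminf_tsum (ι := fun N : ℕ => U N) (s : ℝ) A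
    (l := atTop) (fun N => ENNReal.ofReal √n * 2⁻¹ ^ N)
    (by simpa using ENNReal.Tendsto.const_mul hlim (Or.inr hD))
    (fun N p => {x | dyadicCode p.1.1 x = p.1.2})
    (Eventually.of_forall fun N p => (hediam p.1).trans (mul_le_mul_right (hlevel N p.1 p.2) _))
    (Eventually.of_forall fun N x hx => by
      obtain ⟨k, hk⟩ := hU N x hx
      exact mem_iUnion.2 ⟨⟨_, hk⟩, rfl⟩)
  refine nonpos_iff_eq_zero.1 (hle.trans ?_)
  have hbound : ∀ N, ∑' p : U N, Metric.ediam
      {x : EuclideanSpace ℝ (Fin n) | dyadicCode p.1.1 x = p.1.2} ^ (s : ℝ) ≤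
        ENNReal.ofReal √n ^ (s : ℝ) * (2⁻¹ ^ N) ^ (s : ℝ) := by
    intro N
    calc _ ≤ ∑' p : U N, ENNReal.ofReal √n ^ (s : ℝ) * ((2 : ℝ≥0∞)⁻¹ ^ p.1.1) ^ (s : ℝ) := by
          refine ENNReal.tsum_le_tsum fun p => ?_
          rw [← ENNReal.mul_rpow_of_nonneg _ _ hs'.le]
          exact ENNReal.rpow_le_rpow (hediam p.1) hs'.le
      _ ≤ _ := by
          rw [ENNReal.tsum_mul_left, ← dyadicWeight_apply]
          gcongr
          exact (hUW N).le
  have hlim2 : Tendsto (fun N : ℕ => ENNReal.ofReal √n ^ (s : ℝ) * (2⁻¹ ^ N) ^ (s : ℝ)) atTop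
      (𝓝 0) := by
    have h1 := hlim.ennrpow_const (s : ℝ)
    rw [ENNReal.zero_rpow_of_pos hs'] at h1
    simpa using ENNReal.Tendsto.const_mul h1
      (Or.inr (ENNReal.rpow_ne_top_of_nonneg hs'.le hD))
  exact (liminf_le_liminf (Eventually.of_forall hbound)).trans_eq hlim2.liminf_eq

end Dyadic

/-! ### Frostman's lemma. -/

section Frostman

variable {n : ℕ}

theorem exists_bounded_cellContent_ne_zero {s : ℝ≥0} (hs : 0 < s)
    {E : Set (EuclideanSpace ℝ (Fin n))} (hE : MeasurableSet E) (hsE : (s : ℝ≥0∞) < dimH E) :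
    ∃ A ⊆ E, MeasurableSet A ∧ Bornology.IsBounded A ∧
      cellContent dyadicCode (dyadicWeight n s) A ≠ 0 := by
  by_contra! h
  have h1 : ∀ N : ℕ, μH[s] (E ∩ Metric.closedBall 0 N) = 0 := fun N =>
    hausdorffMeasure_eq_zero_of_cellContent_eq_zero hs
      (h _ inter_subset_left (hE.inter Metric.isClosed_closedBall.measurableSet)
        (Metric.isBounded_closedBall.subset inter_subset_right))
  have h2 : E = ⋃ N : ℕ, E ∩ Metric.closedBall 0 N := by
    rw [← inter_iUnion, Metric.iUnion_closedBall_nat, inter_univ]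
  have h3 : μH[s] E = 0 := by
    rw [h2]
    exact measure_iUnion_null h1
  simp [hausdorffMeasure_of_lt_dimH hsE] at h3

theorem measure_ball_le_of_cell_le {s : ℝ≥0} {μ : Measure (EuclideanSpace ℝ (Fin n))} {C : ℝ≥0∞}
    {j : ℕ} (hμ : ∀ z, μ {x | dyadicCode j x = z} ≤ C * ((2 : ℝ≥0∞)⁻¹ ^ j) ^ (s : ℝ))
    (x : EuclideanSpace ℝ (Fin n)) {r : ℝ} (hr : r ≤ (2 ^ j)⁻¹) :
    μ (Metric.ball x r) ≤ 3 ^ n * (C * ((2 : ℝ≥0∞)⁻¹ ^ j) ^ (s : ℝ)) := by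
  calc μ (Metric.ball x r) ≤ μ (⋃ z ∈ dyadicNeighbors j x, {y | dyadicCode j y = z}) := by
        refine measure_mono fun y hy => mem_iUnion₂.2 ⟨dyadicCode j y, ?_, rfl⟩
        exact dyadicCode_mem_dyadicNeighbors ((Metric.mem_ball.1 hy).le.trans hr)
    _ ≤ ∑ z ∈ dyadicNeighbors j x, μ {y | dyadicCode j y = z} := measure_biUnion_finset_le _ _
    _ ≤ ∑ _z ∈ dyadicNeighbors j x, C * ((2 : ℝ≥0∞)⁻¹ ^ j) ^ (s : ℝ) :=
        Finset.sum_le_sum fun z _ => hμ z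
    _ = _ := by
        rw [Finset.sum_const, card_dyadicNeighbors, nsmul_eq_mul]
        push_cast
        rfl

/-- A decreasing sequence of sets of content bounded below carries, in the limit, a measure with
the Frostman growth condition. -/
theorem exists_frostman_of_decreasing {s : ℝ≥0} {c : ℝ≥0∞} (hc0 : c ≠ 0)
    {A : ℕ → Set (EuclideanSpace ℝ (Fin n))} (hA : Antitone A)
    (hbdd : Bornology.IsBounded (A 0))
    (hcA : ∀ k, c ≤ cellContent dyadicCode (dyadicWeight n s) (A k)) :
    ∃ P : ProbabilityMeasure (EuclideanSpace ℝ (Fin n)),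
      (P : Measure (EuclideanSpace ℝ (Fin n))) (⋂ k, closure (A k))ᶜ = 0 ∧
      ∀ x r, 0 < r → (P : Measure (EuclideanSpace ℝ (Fin n))) (Metric.ball x r) ≤
        (3 ^ n * c⁻¹ + 1) * ENNReal.ofReal (2 * r) ^ (s : ℝ) := by
  have hex := fun k => exists_measure_cell_le (q := dyadicCode) (W := dyadicWeight n s)
    dyadicCode_of_succ measurable_dyadicCode
    (fun j => finite_dyadicCode_image j (hbdd.subset (hA (Nat.zero_le k))))
    (fun p => by rw [dyadicWeight_singleton]; exact inv_two_pow_rpow_ne_top _ _) k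
  choose μ hμA hμc hμfin hμW using hex
  have hμ0 : ∀ k, μ k univ ≠ 0 := fun k =>
    ((pos_iff_ne_zero.2 hc0).trans_le ((hcA k).trans (hμc k))).ne'
  have hprob : ∀ k, IsProbabilityMeasure ((μ k univ)⁻¹ • μ k) := fun k =>
    ⟨by rw [Measure.smul_apply, smul_eq_mul, ENNReal.inv_mul_cancel (hμ0 k) (hμfin k)]⟩
  let P : ℕ → ProbabilityMeasure (EuclideanSpace ℝ (Fin n)) := fun k => ⟨_, hprob k⟩
  have hPle : ∀ k B, (P k : Measure (EuclideanSpace ℝ (Fin n))) B ≤ c⁻¹ * μ k B := by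
    intro k B
    change (μ k univ)⁻¹ * μ k B ≤ c⁻¹ * μ k B
    gcongr
    exact (hcA k).trans (hμc k)
  have hPnull : ∀ k B, MeasurableSet B → A k ⊆ B →
      (P k : Measure (EuclideanSpace ℝ (Fin n))) Bᶜ = 0 := fun k B hB hAB =>
    nonpos_iff_eq_zero.1 ((hPle k _).trans_eq (by rw [hμA k B hB hAB, mul_zero]))
  -- All the measures live on one compact set, so the family is tight and Prokhorov's theorem
  -- applies.
  have hcompact : IsCompact (closure (range P)) := by
    refine isCompact_closure_of_isTightMeasureSet ?_
    rw [isTightMeasureSet_iff_exists_isCompact_measure_compl_le]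
    intro ε _
    refine ⟨closure (A 0), hbdd.isCompact_closure, ?_⟩
    rintro _ ⟨_, ⟨k, rfl⟩, rfl⟩
    rw [hPnull k _ isClosed_closure.measurableSet
      ((hA (Nat.zero_le k)).trans subset_closure)]
    exact zero_le
  obtain ⟨Q, -, hQ⟩ := hcompact.ultrafilter_le_nhds ((hyperfilter ℕ).map P)
    (by
      rw [le_principal_iff]
      exact Filter.mem_of_superset (image_mem_map univ_mem)
        (by rw [image_univ]; exact subset_closure))
  have hlim : Tendsto P (hyperfilter ℕ : Filter ℕ) (𝓝 Q) := hQ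
  have hev : ∀ j : ℕ, ∀ᶠ k in (hyperfilter ℕ : Filter ℕ), j ≤ k := fun j =>
    Nat.hyperfilter_le_atTop (eventually_ge_atTop j)
  -- Portmanteau: upper bounds on open sets pass to the weak limit. The growth condition is
  -- therefore stated for open balls.
  have hopen : ∀ {U : Set (EuclideanSpace ℝ (Fin n))} {a : ℝ≥0∞} (j : ℕ), IsOpen U →
      (∀ k ≥ j, (P k : Measure (EuclideanSpace ℝ (Fin n))) U ≤ a) →
      (Q : Measure (EuclideanSpace ℝ (Fin n))) U ≤ a := by
    intro U a j hU h
    refine (ProbabilityMeasure.le_liminf_measure_open_of_tendsto hlim hU).trans ?_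
    refine liminf_le_of_frequently_le' (Eventually.frequently ?_)
    filter_upwards [hev j] with k hk using h k hk
  refine ⟨Q, ?_, fun x r hr => ?_⟩
  · rw [compl_iInter]
    refine measure_iUnion_null fun j => nonpos_iff_eq_zero.1 ?_
    refine hopen j isClosed_closure.isOpen_compl fun k hk => ?_
    rw [hPnull k _ isClosed_closure.measurableSet ((hA hk).trans subset_closure)]
  -- Large radii are paid for by the `+ 1` in the constant; for `r < 1`, rounding up to a dyadic
  -- scale gives `2⁻ʲ ≤ 2 r`.
  · rcases le_or_gt 1 r with h1 | h1
    · calc (Q : Measure (EuclideanSpace ℝ (Fin n))) (Metric.ball x r) ≤ 1 * 1 := by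
            rw [mul_one]; exact prob_le_one
        _ ≤ _ := by
            gcongr
            · exact le_add_self
            · have h2 : (1 : ℝ≥0∞) ≤ ENNReal.ofReal (2 * r) := by
                rw [← ENNReal.ofReal_one]
                exact ENNReal.ofReal_le_ofReal (by linarith)
              simpa using ENNReal.rpow_le_rpow h2 s.coe_nonneg
    · obtain ⟨j, hj1, hj2⟩ := exists_nat_pow_near_of_lt_one hr h1.le
        (show (0 : ℝ) < 1 / 2 by norm_num) (by norm_num)
      have hj2' : r ≤ (2 ^ j)⁻¹ := by simpa using hj2
      have hj1' : ((2 : ℝ≥0∞)⁻¹ ^ j) ≤ ENNReal.ofReal (2 * r) := by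
        rw [← ENNReal.ofReal_ofNat 2, ← ENNReal.ofReal_inv_of_pos zero_lt_two,
          ← ENNReal.ofReal_pow (by norm_num)]
        refine ENNReal.ofReal_le_ofReal ?_
        rw [one_div, pow_succ] at hj1
        linarith
      refine (hopen j Metric.isOpen_ball fun k hk => measure_ball_le_of_cell_le (s := s) (C := c⁻¹)
        (fun z => (hPle k _).trans ?_) x hj2').trans ?_
      · gcongr
        rw [← dyadicWeight_singleton s (j, z)]
        exact hμW k j hk z
      · rw [← mul_assoc]
        gcongr
        exact le_self_add

/-- **Frostman's lemma** for Borel sets. -/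
theorem exists_frostman_measure {s : ℝ≥0} (hs : 0 < s) {E : Set (EuclideanSpace ℝ (Fin n))}
    (hE : MeasurableSet E) (hsE : (s : ℝ≥0∞) < dimH E) :
    ∃ P : Measure (EuclideanSpace ℝ (Fin n)), IsProbabilityMeasure P ∧ P Eᶜ = 0 ∧
      ∃ C : ℝ≥0∞, C ≠ ∞ ∧ ∀ x r, 0 < r →
        P (Metric.ball x r) ≤ C * ENNReal.ofReal r ^ (s : ℝ) := by
  obtain ⟨A, hAE, hAm, hAb, hA0⟩ := exists_bounded_cellContent_ne_zero hs hE hsE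
  -- A Borel set is a continuous image of Baire space; capacitability then yields decreasing sets of
  -- content above `c` whose closures shrink into `A`.
  have hAan := hAm.analyticSet
  rw [AnalyticSet] at hAan
  rcases hAan with rfl | ⟨f, hf, rfl⟩
  · exact absurd cellContent_empty hA0
  obtain ⟨c, hc0, hcA⟩ := exists_between (pos_iff_ne_zero.2 hA0)
  obtain ⟨N, hN⟩ := exists_baireBox_lt (cellContent dyadicCode (dyadicWeight n s))
    (fun B hB c hc => exists_le_cellContent_of_iUnion dyadicCode_of_succ hB hc) f hcA
  obtain ⟨P, hP, hPball⟩ := exists_frostman_of_decreasing (s := s) (A := fun k => f '' baireBox N k)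
    hc0.ne'
    (fun j k hjk => image_mono fun x hx i hi => hx i (hi.trans_le hjk))
    (hAb.subset (image_subset_range _ _)) (fun k => (hN k).le)
  refine ⟨P, inferInstance, measure_mono_null (compl_subset_compl.2 ?_) hP,
    (3 ^ n * c⁻¹ + 1) * 2 ^ (s : ℝ), ?_, fun x r hr => (hPball x r hr).trans_eq ?_⟩
  · exact (iInter_closure_image_baireBox_subset hf N).trans hAE
  · refine ENNReal.mul_ne_top (ENNReal.add_ne_top.2 ⟨ENNReal.mul_ne_top (by simp) ?_, by simp⟩)
      (ENNReal.rpow_ne_top_of_nonneg s.2 (by simp))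
    simpa using hc0.ne'
  · rw [ENNReal.ofReal_mul zero_le_two, ENNReal.ofReal_ofNat,
      ENNReal.mul_rpow_of_nonneg _ _ s.coe_nonneg,
      mul_assoc]

end Frostman

/-! ### Gaussian measures, their Fourier transforms and their projections. -/

section GaussianFourier

variable {V : Type*} [NormedAddCommGroup V] [InnerProductSpace ℝ V] [FiniteDimensional ℝ V]
  [MeasurableSpace V] [BorelSpace V]

open scoped RealInnerProductSpace

/-- The measure with density `exp (-a ‖x‖ ^ 2)`. -/
def gaussianDensityMeasure (V : Type*) [NormedAddCommGroup V] [InnerProductSpace ℝ V]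
    [FiniteDimensional ℝ V] [MeasurableSpace V] [BorelSpace V] (a : ℝ) : Measure V :=
  volume.withDensity fun x => ENNReal.ofReal (Real.exp (-a * ‖x‖ ^ 2))

theorem integrable_exp_neg_mul_sq_norm {a : ℝ} (ha : 0 < a) :
    Integrable fun x : V => Real.exp (-a * ‖x‖ ^ 2) := by
  have h := GaussianFourier.integrable_cexp_neg_mul_sq_norm_add (V := V) (b := (a : ℂ))
    (by simpa using ha) 0 0
  refine h.norm.congr (Eventually.of_forall fun x => ?_)
  simp only [Complex.norm_exp]
  congr 1
  simp [← Complex.ofReal_pow, ← Complex.ofReal_mul]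

theorem isFiniteMeasure_gaussianDensityMeasure {a : ℝ} (ha : 0 < a) :
    IsFiniteMeasure (gaussianDensityMeasure V a) :=
  isFiniteMeasure_withDensity_ofReal (integrable_exp_neg_mul_sq_norm ha).2

theorem charFun_gaussianDensityMeasure {a : ℝ} (ha : 0 < a) (t : V) :
    charFun (gaussianDensityMeasure V a) t =
      (((Real.pi / a) ^ (Module.finrank ℝ V / 2 : ℝ) * Real.exp (-(‖t‖ ^ 2 / (4 * a))) : ℝ) : ℂ) := by
  rw [charFun_apply, gaussianDensityMeasure,
    integral_withDensity_eq_integral_toReal_smul (by fun_prop) (by simp)]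
  have h := GaussianFourier.integral_cexp_neg_mul_sq_norm_add (V := V) (b := (a : ℂ))
    (by simpa using ha) Complex.I t
  calc _ = ∫ v : V, Complex.exp (-a * ‖v‖ ^ 2 + Complex.I * ⟪t, v⟫) := by
        refine integral_congr_ae (Eventually.of_forall fun v => ?_)
        simp only
        rw [ENNReal.toReal_ofReal (Real.exp_pos _).le, Complex.exp_add, Complex.real_smul,
          real_inner_comm t v]
        push_cast
        ring_nf
    _ = _ := by
        rw [h]
        push_cast
        rw [Complex.ofReal_cpow (by positivity)]
        push_cast
        congr 2
        simp
        ring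

theorem charFun_map_orthogonalProjection (K : Submodule ℝ V) (μ : Measure V) (t : K) :
    charFun (μ.map K.orthogonalProjectionOnto) t = charFun μ (t : V) := by
  rw [charFun_apply, charFun_apply, integral_map (by fun_prop)
    (by exact (by fun_prop : Continuous _).aestronglyMeasurable)]
  simp

/-- Both sides have the same characteristic function; the constant is the Gaussian integral over the
orthogonal complement. -/
theorem map_orthogonalProjection_gaussianDensityMeasure {a : ℝ} (ha : 0 < a)
    (K : Submodule ℝ V) :
    (gaussianDensityMeasure V a).map K.orthogonalProjectionOnto =
      ENNReal.ofReal ((Real.pi / a) ^ ((Module.finrank ℝ V - Module.finrank ℝ K : ℝ) / 2)) •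
        gaussianDensityMeasure K a := by
  have := isFiniteMeasure_gaussianDensityMeasure (V := V) ha
  have := isFiniteMeasure_gaussianDensityMeasure (V := K) ha
  have : IsFiniteMeasure (ENNReal.ofReal ((Real.pi / a) ^
      ((Module.finrank ℝ V - Module.finrank ℝ K : ℝ) / 2)) • gaussianDensityMeasure K a) :=
    Measure.smul_finite _ ENNReal.ofReal_ne_top
  refine Measure.ext_of_charFun (funext fun t => ?_)
  rw [charFun_map_orthogonalProjection, charFun_gaussianDensityMeasure ha, charFun_apply,
    integral_smul_measure, ← charFun_apply, charFun_gaussianDensityMeasure ha,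
    ENNReal.toReal_ofReal (by positivity), Complex.real_smul, ← Complex.ofReal_mul, ← mul_assoc,
    ← Real.rpow_add (by positivity)]
  congr 3
  ring_nf

end GaussianFourier

/-! ### Energies as integrals of the squared Fourier transform. -/

section EnergyIdentity

variable {V : Type*} [NormedAddCommGroup V] [InnerProductSpace ℝ V] [FiniteDimensional ℝ V]
  [MeasurableSpace V] [BorelSpace V]

open scoped RealInnerProductSpace

theorem charFun_map_sub (μ : Measure V) [IsFiniteMeasure μ] (ξ : V) :
    charFun ((μ.prod μ).map fun p => p.1 - p.2) ξ = ((‖charFun μ ξ‖ ^ 2 : ℝ) : ℂ) := by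
  rw [charFun_apply, integral_map (by fun_prop)
    (by exact (by fun_prop : Continuous _).aestronglyMeasurable)]
  calc ∫ p : V × V, Complex.exp (⟪p.1 - p.2, ξ⟫ * Complex.I) ∂μ.prod μ
      = ∫ p : V × V, Complex.exp (⟪p.1, ξ⟫ * Complex.I) *
          Complex.exp (⟪p.2, -ξ⟫ * Complex.I) ∂μ.prod μ := by
        refine integral_congr_ae (Eventually.of_forall fun p => ?_)
        simp only [← Complex.exp_add, inner_sub_left, inner_neg_right]
        congr 1
        push_cast
        ring
    _ = charFun μ ξ * charFun μ (-ξ) := by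
        rw [integral_prod_mul (fun x : V => Complex.exp (⟪x, ξ⟫ * Complex.I))
          (fun x : V => Complex.exp (⟪x, -ξ⟫ * Complex.I)), charFun_apply, charFun_apply]
    _ = _ := by
        rw [charFun_neg, Complex.mul_conj, Complex.normSq_eq_norm_sq]

theorem integral_charFun_comm (σ ρ : Measure V) [IsFiniteMeasure σ] [IsFiniteMeasure ρ] :
    ∫ ξ, charFun σ ξ ∂ρ = ∫ x, charFun ρ x ∂σ := by
  simp only [charFun_apply]
  rw [integral_integral_swap]
  · refine integral_congr_ae (Eventually.of_forall fun x =>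
      integral_congr_ae (Eventually.of_forall fun ξ => ?_))
    simp only
    rw [real_inner_comm]
  · refine Integrable.of_bound (C := 1) (by
      exact (by fun_prop : Continuous _).aestronglyMeasurable) ?_
    refine Eventually.of_forall ?_
    rintro ⟨ξ, x⟩
    simp [Complex.norm_exp]

/-- The distribution of the difference of two independent points distributed by `μ`. -/
def differenceMeasure (μ : Measure V) : Measure V := (μ.prod μ).map fun p => p.1 - p.2

theorem lintegral_differenceMeasure (μ : Measure V) [SFinite μ] {f : V → ℝ≥0∞}
    (hf : Measurable f) :
    ∫⁻ z, f z ∂differenceMeasure μ = ∫⁻ x, ∫⁻ y, f (x - y) ∂μ ∂μ := by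
  rw [differenceMeasure, lintegral_map hf (by fun_prop), lintegral_prod _ (by fun_prop)]

instance (μ : Measure V) [IsFiniteMeasure μ] : IsFiniteMeasure (differenceMeasure μ) :=
  Measure.isFiniteMeasure_map _ _

/-- The energy of `μ` for a positive definite kernel `k`, the characteristic function of `ρ`. -/
theorem lintegral_norm_charFun_sq {μ ρ : Measure V} [IsFiniteMeasure μ] [IsFiniteMeasure ρ]
    {k : V → ℝ} (hk0 : 0 ≤ k) (hρ : ∀ p, charFun ρ p = (k p : ℂ)) :
    ∫⁻ ξ, ENNReal.ofReal (‖charFun μ ξ‖ ^ 2) ∂ρ =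
      ∫⁻ z, ENNReal.ofReal (k z) ∂differenceMeasure μ := by
  have hk : Measurable k := by
    have : k = fun p => (charFun ρ p).re := by
      ext p
      simp [hρ]
    rw [this]
    exact Complex.measurable_re.comp measurable_charFun
  -- The transform of the difference law is `‖charFun μ ξ‖ ^ 2`, and Fubini moves the transform from
  -- it onto `ρ`.
  have h1 : ∫ ξ, ‖charFun μ ξ‖ ^ 2 ∂ρ = ∫ x, k x ∂differenceMeasure μ := by
    have h := integral_charFun_comm (differenceMeasure μ) ρ
    simp only [differenceMeasure, charFun_map_sub, hρ] at h
    rw [← differenceMeasure] at h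
    rwa [integral_complex_ofReal, integral_complex_ofReal, Complex.ofReal_inj] at h
  have hint1 : Integrable (fun ξ => ‖charFun μ ξ‖ ^ 2) ρ := by
    refine Integrable.of_bound (C := μ.real univ ^ 2)
      (measurable_charFun.norm.pow_const 2).aestronglyMeasurable ?_
    refine Eventually.of_forall fun ξ => ?_
    rw [Real.norm_of_nonneg (by positivity)]
    gcongr
    exact norm_charFun_le ξ
  have hint2 : Integrable k (differenceMeasure μ) := by
    refine Integrable.of_bound (C := ρ.real univ) hk.aestronglyMeasurable ?_
    refine Eventually.of_forall fun x => ?_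
    rw [← Complex.norm_real, ← hρ]
    exact norm_charFun_le x
  rw [← ofReal_integral_eq_lintegral_ofReal hint1 (Eventually.of_forall fun ξ => by positivity),
    h1, ofReal_integral_eq_lintegral_ofReal hint2 (Eventually.of_forall hk0)]

end EnergyIdentity

/-! ### Gaussian masses of balls and comparison of radial profiles. -/

section Domination

variable {V : Type*} [NormedAddCommGroup V] [InnerProductSpace ℝ V] [FiniteDimensional ℝ V]
  [MeasurableSpace V] [BorelSpace V]

/-- The volume of the unit ball of an `m`-dimensional Euclidean space. -/
def unitBallVolume (m : ℕ) : ℝ≥0∞ := volume (Metric.closedBall (0 : EuclideanSpace ℝ (Fin m)) 1)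

theorem unitBallVolume_ne_top (m : ℕ) : unitBallVolume m ≠ ∞ := measure_closedBall_lt_top.ne

theorem unitBallVolume_ne_zero (m : ℕ) : unitBallVolume m ≠ 0 :=
  (Metric.measure_closedBall_pos volume _ one_pos).ne'

theorem volume_closedBall_eq_mul_unitBallVolume (x : V) {r : ℝ} (hr : 0 ≤ r) :
    volume (Metric.closedBall x r) =
      ENNReal.ofReal (r ^ Module.finrank ℝ V) * unitBallVolume (Module.finrank ℝ V) := by
  rw [Measure.addHaar_closedBall' volume x hr, unitBallVolume]
  congr 1
  have e := (stdOrthonormalBasis ℝ V).repr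
  rw [← e.measurePreserving.measure_preimage Metric.isClosed_closedBall.nullMeasurableSet,
    e.preimage_closedBall]
  simp

theorem gaussianDensityMeasure_closedBall_ge {a : ℝ} {x : V} {r c : ℝ} (hr : 0 ≤ r)
    (hc : ∀ y ∈ Metric.closedBall x r, c ≤ Real.exp (-a * ‖y‖ ^ 2)) :
    ENNReal.ofReal c * (ENNReal.ofReal (r ^ Module.finrank ℝ V) *
      unitBallVolume (Module.finrank ℝ V)) ≤
        gaussianDensityMeasure V a (Metric.closedBall x r) := by
  rw [gaussianDensityMeasure, withDensity_apply _ Metric.isClosed_closedBall.measurableSet,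
    ← volume_closedBall_eq_mul_unitBallVolume x hr, ← setLIntegral_const]
  exact setLIntegral_mono (by fun_prop) fun y hy => ENNReal.ofReal_le_ofReal (hc y hy)

theorem gaussianDensityMeasure_projection_preimage_le {a : ℝ} (ha : 0 < a) (K : Submodule ℝ V)
    {x : V} {r b : ℝ} (hr : 0 ≤ r)
    (hb : ∀ y ∈ Metric.closedBall x r, Real.exp (-a * ‖y‖ ^ 2) ≤ b) :
    gaussianDensityMeasure V a {y | K.starProjection y ∈ Metric.closedBall x r} ≤
      ENNReal.ofReal ((Real.pi / a) ^ ((Module.finrank ℝ V - Module.finrank ℝ K : ℝ) / 2)) *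
        (ENNReal.ofReal b * (ENNReal.ofReal (r ^ Module.finrank ℝ K) *
          unitBallVolume (Module.finrank ℝ K))) := by
  set S : Set K := {y : K | (y : V) ∈ Metric.closedBall x r} with hS
  have hSm : MeasurableSet S :=
    (Metric.isClosed_closedBall.preimage continuous_subtype_val).measurableSet
  have hSsub : S ⊆ Metric.closedBall (K.orthogonalProjectionOnto x) r := by
    intro y hy
    rw [Metric.mem_closedBall, dist_eq_norm]
    have h1 : y - K.orthogonalProjectionOnto x = K.orthogonalProjectionOnto ((y : V) - x) := by
      rw [map_sub, Submodule.orthogonalProjectionOnto_mem_subspace_eq_self]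
    rw [h1]
    refine (K.norm_orthogonalProjectionOnto_apply_le _).trans ?_
    rw [← dist_eq_norm]
    exact hy
  have h1 : gaussianDensityMeasure V a {y | K.starProjection y ∈ Metric.closedBall x r} =
      (gaussianDensityMeasure V a).map K.orthogonalProjectionOnto S := by
    rw [Measure.map_apply (by fun_prop) hSm]
    rfl
  rw [h1, map_orthogonalProjection_gaussianDensityMeasure ha, Measure.smul_apply, smul_eq_mul]
  gcongr
  calc gaussianDensityMeasure K a S
      = ∫⁻ y in S, ENNReal.ofReal (Real.exp (-a * ‖y‖ ^ 2)) := by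
        rw [gaussianDensityMeasure, withDensity_apply _ hSm]
    _ ≤ ∫⁻ _y in S, ENNReal.ofReal b :=
        setLIntegral_mono measurable_const fun y hy => ENNReal.ofReal_le_ofReal (hb y hy)
    _ = ENNReal.ofReal b * volume S := setLIntegral_const _ _
    _ ≤ _ := by
        rw [← volume_closedBall_eq_mul_unitBallVolume (K.orthogonalProjectionOnto x) hr]
        gcongr

/-- Comparison of `t ^ (-d) * exp (-t ^ 2 / 2)` with one of the Gaussians of scale `2⁻ʲ`. -/
theorem exists_rpow_neg_mul_exp_le (d : ℕ) {t : ℝ} (ht : 0 < t) :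
    ∃ j : ℕ, (t ^ d)⁻¹ * Real.exp (-(1 / 2) * t ^ 2) ≤
      (2 ^ d * Real.exp (1 / 4)) * (2 ^ (j * d) * Real.exp (-(4 ^ j / 4) * t ^ 2)) := by
  rcases le_or_gt 1 t with h1 | h1
  · refine ⟨0, ?_⟩
    have e1 : (t ^ d)⁻¹ ≤ 1 := inv_le_one_of_one_le₀ (one_le_pow₀ h1)
    have e2 : Real.exp (-(1 / 2) * t ^ 2) ≤ Real.exp (-(4 ^ 0 / 4) * t ^ 2) :=
      Real.exp_le_exp.2 (by nlinarith [sq_nonneg t])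
    have e3 : (1 : ℝ) ≤ 2 ^ d * Real.exp (1 / 4) :=
      one_le_mul_of_one_le_of_one_le (one_le_pow₀ one_le_two) (Real.one_le_exp (by norm_num))
    calc (t ^ d)⁻¹ * Real.exp (-(1 / 2) * t ^ 2) ≤ 1 * Real.exp (-(4 ^ 0 / 4) * t ^ 2) := by gcongr
      _ ≤ (2 ^ d * Real.exp (1 / 4)) * Real.exp (-(4 ^ 0 / 4) * t ^ 2) := by gcongr
      _ = _ := by simp
  -- With `2 ^ j * t` between `1 / 2` and `1`, the power `(t ^ d)⁻¹` is comparable to `2 ^ (j * d)`,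
  -- and the `j`-th Gaussian is still at least `exp (-1 / 4)`.
  · obtain ⟨j, hj1, hj2⟩ := exists_nat_pow_near_of_lt_one ht h1.le
      (show (0 : ℝ) < 1 / 2 by norm_num) (by norm_num)
    refine ⟨j, ?_⟩
    have h2j : (0 : ℝ) < 2 ^ j := by positivity
    have hjt : 2 ^ j * t ≤ 1 := by
      calc 2 ^ j * t ≤ 2 ^ j * (1 / 2) ^ j := by gcongr
        _ = 1 := by rw [← mul_pow]; norm_num
    have hjt2 : 1 ≤ 2 * 2 ^ j * t := by
      calc (1 : ℝ) = 2 * 2 ^ j * (1 / 2) ^ (j + 1) := by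
            rw [pow_succ, mul_comm ((1 / 2 : ℝ) ^ j), ← mul_assoc, mul_right_comm 2, mul_assoc,
              ← mul_pow]
            norm_num
        _ ≤ _ := by gcongr
    have e1 : (t ^ d)⁻¹ ≤ 2 ^ d * 2 ^ (j * d) := by
      rw [pow_mul, ← mul_pow, ← inv_pow]
      gcongr
      rw [← one_div, div_le_iff₀ ht]
      exact hjt2
    have e2 : Real.exp (-(1 / 2) * t ^ 2) ≤ Real.exp (1 / 4) * Real.exp (-(4 ^ j / 4) * t ^ 2) := by
      rw [← Real.exp_add]
      refine Real.exp_le_exp.2 ?_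
      have : (4 : ℝ) ^ j * t ^ 2 ≤ 1 := by
        rw [show (4 : ℝ) = 2 ^ 2 by norm_num, ← pow_mul, mul_comm 2 j, pow_mul, ← mul_pow]
        exact pow_le_one₀ (by positivity) hjt
      nlinarith [sq_nonneg t]
    calc (t ^ d)⁻¹ * Real.exp (-(1 / 2) * t ^ 2)
        ≤ (2 ^ d * 2 ^ (j * d)) * (Real.exp (1 / 4) * Real.exp (-(4 ^ j / 4) * t ^ 2)) := by gcongr
      _ = _ := by ring

end Domination

theorem eventually_exp_le_two_mul {V : Type*} [NormedAddCommGroup V] (a : ℝ) (x : V) :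
    ∀ᶠ r in 𝓝[>] (0 : ℝ),
    ∀ y ∈ Metric.closedBall x r, Real.exp (-a * ‖y‖ ^ 2) ≤ 2 * Real.exp (-a * ‖x‖ ^ 2) ∧
      Real.exp (-a * ‖x‖ ^ 2) / 2 ≤ Real.exp (-a * ‖y‖ ^ 2) := by
  have hc : Continuous fun y : V => Real.exp (-a * ‖y‖ ^ 2) := by fun_prop
  have hpos := Real.exp_pos (-a * ‖x‖ ^ 2)
  have h1 : ∀ᶠ y in 𝓝 x, Real.exp (-a * ‖y‖ ^ 2) ≤ 2 * Real.exp (-a * ‖x‖ ^ 2) ∧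
      Real.exp (-a * ‖x‖ ^ 2) / 2 ≤ Real.exp (-a * ‖y‖ ^ 2) :=
    (hc.continuousAt.eventually_le_const (by linarith)).and
      (hc.continuousAt.eventually_const_le (by linarith))
  obtain ⟨ε, hε, h⟩ := Metric.eventually_nhds_iff_ball.1 h1
  filter_upwards [Ioo_mem_nhdsGT hε] with r hr y hy
  exact h y (Metric.closedBall_subset_ball hr.2 hy)

/-! ### The law of a randomly projected Gaussian. -/

section ProjectedGaussian

open scoped Pointwise

/-- Subspaces are invariant under dilation, so the hypothesis on unit vectors rescales to every
nonzero vector. -/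
theorem measure_infDist_le {V Ω : Type*} [NormedAddCommGroup V] [InnerProductSpace ℝ V]
    [MeasurableSpace Ω] {γ : Measure Ω} {K : Ω → Submodule ℝ V} {d : ℕ} {C : ℝ≥0∞}
    (hγ : ∀ ξ : V, ‖ξ‖ = 1 → ∀ ρ : ℝ, 0 < ρ →
      γ {ω | Metric.infDist ξ (K ω : Set V) ≤ ρ} ≤ C * ENNReal.ofReal (ρ ^ d))
    {x : V} (hx : x ≠ 0) {r : ℝ} (hr : 0 < r) :
    γ {ω | Metric.infDist x (K ω : Set V) ≤ r} ≤ C * ENNReal.ofReal ((r / ‖x‖) ^ d) := by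
  have hx' : 0 < ‖x‖ := norm_pos_iff.2 hx
  refine (measure_mono fun ω hω => ?_).trans
    (hγ (‖x‖⁻¹ • x) ?_ (r / ‖x‖) (by positivity))
  · have hsub : (‖x‖⁻¹ • (K ω : Set V)) ⊆ K ω := by
      rintro _ ⟨y, hy, rfl⟩
      exact (K ω).smul_mem _ hy
    have h1 := infDist_smul₀ (inv_ne_zero hx'.ne') (K ω : Set V) x
    rw [norm_inv, norm_norm] at h1
    change Metric.infDist (‖x‖⁻¹ • x) (K ω : Set V) ≤ r / ‖x‖
    calc _ ≤ Metric.infDist (‖x‖⁻¹ • x) (‖x‖⁻¹ • (K ω : Set V)) :=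
          Metric.infDist_le_infDist_of_subset hsub ⟨_, 0, (K ω).zero_mem, rfl⟩
      _ = ‖x‖⁻¹ * Metric.infDist x (K ω : Set V) := h1
      _ ≤ ‖x‖⁻¹ * r := by gcongr; exact hω
      _ = r / ‖x‖ := by rw [div_eq_inv_mul]
  · rw [norm_smul, norm_inv, norm_norm, inv_mul_cancel₀ hx'.ne']

variable {V : Type*} [NormedAddCommGroup V] [InnerProductSpace ℝ V] [FiniteDimensional ℝ V]
  [MeasurableSpace V] [BorelSpace V] {Ω : Type*} [MeasurableSpace Ω]

/-- The distribution of `π_ω x` for `ω` distributed by `γ` and `x` by a Gaussian. -/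
def projectedGaussian (γ : Measure Ω) (K : Ω → Submodule ℝ V) : Measure V :=
  (γ.prod (gaussianDensityMeasure V (1 / 2))).map fun p => (K p.1).starProjection p.2

variable {γ : Measure Ω} {K : Ω → Submodule ℝ V} {m d : ℕ} {C : ℝ≥0∞}

/-- Only subspaces passing within `r` of `x` contribute, and each contributes at most the mass of an
`m`-dimensional ball of radius `r`. This is where the geometric condition on `γ` enters the estimate
of the density. -/
theorem projectedGaussian_closedBall_le
    (hK : Measurable fun p : Ω × V => (K p.1).starProjection p.2)
    (hm : ∀ ω, Module.finrank ℝ (K ω) = m) (hV : Module.finrank ℝ V = m + d) {x : V} {r b : ℝ}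
    (hr : 0 ≤ r) (hb : ∀ y ∈ Metric.closedBall x r, Real.exp (-(1 / 2) * ‖y‖ ^ 2) ≤ b) :
    projectedGaussian γ K (Metric.closedBall x r) ≤
      ENNReal.ofReal ((Real.pi / (1 / 2)) ^ ((d : ℝ) / 2)) * (ENNReal.ofReal b *
        (ENNReal.ofReal (r ^ m) * unitBallVolume m)) *
          γ {ω | Metric.infDist x (K ω : Set V) ≤ r} := by
  have := isFiniteMeasure_gaussianDensityMeasure (V := V) (a := 1 / 2) (by norm_num)
  rw [projectedGaussian, Measure.map_apply hK Metric.isClosed_closedBall.measurableSet,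
    Measure.prod_apply (hK Metric.isClosed_closedBall.measurableSet)]
  refine le_trans (lintegral_mono fun ω => ?_) (lintegral_indicator_const_le _ _)
  change gaussianDensityMeasure V (1 / 2)
    {y | (K ω).starProjection y ∈ Metric.closedBall x r} ≤ _
  by_cases hω : Metric.infDist x (K ω : Set V) ≤ r
  · rw [indicator_of_mem (s := {ω | Metric.infDist x (K ω : Set V) ≤ r}) hω]
    have h := gaussianDensityMeasure_projection_preimage_le (a := 1 / 2) (by norm_num) (K ω) hr hb
    rw [hm, hV] at h
    simpa using h
  · rw [indicator_of_notMem (s := {ω | Metric.infDist x (K ω : Set V) ≤ r}) hω, nonpos_iff_eq_zero]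
    convert measure_empty (μ := gaussianDensityMeasure V (1 / 2))
    refine eq_empty_iff_forall_notMem.2 fun y hy => hω ?_
    refine (Metric.infDist_le_dist_of_mem (Submodule.starProjection_apply_mem (K ω) y)).trans ?_
    rw [dist_comm]
    exact hy

theorem isFiniteMeasure_projectedGaussian [IsFiniteMeasure γ] : IsFiniteMeasure (projectedGaussian γ K) := by
  have := isFiniteMeasure_gaussianDensityMeasure (V := V) (a := 1 / 2) (by norm_num)
  exact Measure.isFiniteMeasure_map _ _

/-- The density bound blows up at the origin when `d > 0`, so an atom there has to be excluded
separately; `m ≠ 0` makes `r ^ m` tend to zero. -/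
theorem projectedGaussian_singleton_zero [IsFiniteMeasure γ]
    (hK : Measurable fun p : Ω × V => (K p.1).starProjection p.2)
    (hm : ∀ ω, Module.finrank ℝ (K ω) = m) (hV : Module.finrank ℝ V = m + d) (hm0 : m ≠ 0) :
    projectedGaussian γ K {0} = 0 := by
  have hlim : Tendsto (fun r : ℝ => ENNReal.ofReal ((Real.pi / (1 / 2)) ^ ((d : ℝ) / 2)) *
      (ENNReal.ofReal 1 * (ENNReal.ofReal (r ^ m) * unitBallVolume m)) * γ univ) (𝓝[>] 0) (𝓝 0) := by
    have h1 : Tendsto (fun r : ℝ => ENNReal.ofReal (r ^ m)) (𝓝[>] 0) (𝓝 0) := by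
      have : Tendsto (fun r : ℝ => ENNReal.ofReal (r ^ m)) (𝓝 0) (𝓝 (ENNReal.ofReal (0 ^ m))) :=
        (ENNReal.continuous_ofReal.comp (continuous_pow m)).tendsto 0
      rw [zero_pow hm0, ENNReal.ofReal_zero] at this
      exact this.mono_left nhdsWithin_le_nhds
    have h2 := ENNReal.Tendsto.mul_const h1 (Or.inr (unitBallVolume_ne_top m))
    have h3 := ENNReal.Tendsto.const_mul h2 (Or.inr (ENNReal.ofReal_ne_top (r := 1)))
    have h4 := ENNReal.Tendsto.const_mul h3 (Or.inr (ENNReal.ofReal_ne_top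
      (r := (Real.pi / (1 / 2)) ^ ((d : ℝ) / 2))))
    have h5 := ENNReal.Tendsto.mul_const h4 (Or.inr (measure_ne_top γ univ))
    simpa using h5
  refine nonpos_iff_eq_zero.1 (ge_of_tendsto hlim ?_)
  filter_upwards [self_mem_nhdsWithin] with r hr
  calc projectedGaussian γ K {0} ≤ projectedGaussian γ K (Metric.closedBall 0 r) :=
        measure_mono (by simpa using (mem_Ioi.1 hr).le)
    _ ≤ _ := projectedGaussian_closedBall_le hK hm hV (mem_Ioi.1 hr).le fun y _ =>
        Real.exp_le_one_iff.2 (by nlinarith [sq_nonneg ‖y‖])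
    _ ≤ _ := by
        gcongr
        exact subset_univ _

/-- The constant of the domination of `projectedGaussian` by Gaussians. -/
def dominationConst (m d : ℕ) (C : ℝ≥0∞) : ℝ≥0∞ :=
  ENNReal.ofReal ((Real.pi / (1 / 2)) ^ ((d : ℝ) / 2)) * unitBallVolume m * C * 4 *
    ENNReal.ofReal (2 ^ d * Real.exp (1 / 4)) * (unitBallVolume (m + d))⁻¹

theorem dominationConst_ne_top (m d : ℕ) (hC : C ≠ ∞) : dominationConst m d C ≠ ∞ := by
  have h1 := unitBallVolume_ne_top m
  have h2 : (unitBallVolume (m + d))⁻¹ ≠ ∞ := ENNReal.inv_ne_top.2 (unitBallVolume_ne_zero _)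
  unfold dominationConst
  finiteness

theorem eventually_projectedGaussian_closedBall_le
    (hK : Measurable fun p : Ω × V => (K p.1).starProjection p.2)
    (hm : ∀ ω, Module.finrank ℝ (K ω) = m) (hV : Module.finrank ℝ V = m + d)
    (hγ : ∀ ξ : V, ‖ξ‖ = 1 → ∀ ρ : ℝ, 0 < ρ →
      γ {ω | Metric.infDist ξ (K ω : Set V) ≤ ρ} ≤ C * ENNReal.ofReal (ρ ^ d))
    {x : V} (hx : x ≠ 0) {j : ℕ} (hj : (‖x‖ ^ d)⁻¹ * Real.exp (-(1 / 2) * ‖x‖ ^ 2) ≤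
      (2 ^ d * Real.exp (1 / 4)) * (2 ^ (j * d) * Real.exp (-(4 ^ j / 4) * ‖x‖ ^ 2))) :
    ∀ᶠ r in 𝓝[>] (0 : ℝ), projectedGaussian γ K (Metric.closedBall x r) ≤
      ((dominationConst m d C * 2 ^ (j * d)) • gaussianDensityMeasure V (4 ^ j / 4))
        (Metric.closedBall x r) := by
  filter_upwards [eventually_exp_le_two_mul (1 / 2) x, eventually_exp_le_two_mul (4 ^ j / 4) x,
    self_mem_nhdsWithin] with r h1 h2 hr
  have hr0 : 0 < r := hr
  have hx' : 0 < ‖x‖ := norm_pos_iff.2 hx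
  have hU0 := unitBallVolume_ne_zero (m + d)
  have hUt := unitBallVolume_ne_top (m + d)
  set A := ENNReal.ofReal ((Real.pi / (1 / 2)) ^ ((d : ℝ) / 2)) with hA
  set U := unitBallVolume m
  set U' := unitBallVolume (m + d)
  set D := (2 ^ d * Real.exp (1 / 4) : ℝ) with hD
  set e := Real.exp (-(4 ^ j / 4) * ‖x‖ ^ 2)
  set f := Real.exp (-(1 / 2) * ‖x‖ ^ 2)
  have hlow := gaussianDensityMeasure_closedBall_ge hr0.le fun y hy => (h2 y hy).2
  rw [hV] at hlow
  have hreal : 2 * f * (r ^ m) * ((r / ‖x‖) ^ d) ≤ D * 2 ^ (j * d) * 4 * (e / 2 * r ^ (m + d)) := by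
    calc 2 * f * (r ^ m) * ((r / ‖x‖) ^ d) = 2 * r ^ (m + d) * ((‖x‖ ^ d)⁻¹ * f) := by
          rw [div_pow, pow_add]; ring
      _ ≤ 2 * r ^ (m + d) * (D * (2 ^ (j * d) * e)) := by gcongr
      _ = _ := by ring
  calc projectedGaussian γ K (Metric.closedBall x r)
      ≤ A * (ENNReal.ofReal (2 * f) * (ENNReal.ofReal (r ^ m) * U)) *
          γ {ω | Metric.infDist x (K ω : Set V) ≤ r} :=
        projectedGaussian_closedBall_le hK hm hV hr0.le fun y hy => (h1 y hy).1
    _ ≤ A * (ENNReal.ofReal (2 * f) * (ENNReal.ofReal (r ^ m) * U)) *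
          (C * ENNReal.ofReal ((r / ‖x‖) ^ d)) := by
        gcongr
        exact measure_infDist_le hγ hx hr0
    _ = A * U * C * ENNReal.ofReal (2 * f * (r ^ m) * ((r / ‖x‖) ^ d)) := by
        rw [ENNReal.ofReal_mul (p := 2 * f * r ^ m) (by positivity),
          ENNReal.ofReal_mul (p := 2 * f) (by positivity)]
        ring
    _ ≤ A * U * C * ENNReal.ofReal (D * 2 ^ (j * d) * 4 * (e / 2 * r ^ (m + d))) := by gcongr
    _ = A * U * C * 4 * ENNReal.ofReal D * (U'⁻¹ * U') * 2 ^ (j * d) *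
          (ENNReal.ofReal (e / 2) * ENNReal.ofReal (r ^ (m + d))) := by
        rw [ENNReal.inv_mul_cancel hU0 hUt,
          ENNReal.ofReal_mul (p := D * 2 ^ (j * d) * 4) (by positivity),
          ENNReal.ofReal_mul (p := D * 2 ^ (j * d)) (by positivity),
          ENNReal.ofReal_mul (p := D) (by positivity),
          ENNReal.ofReal_mul (p := e / 2) (by positivity), ENNReal.ofReal_pow zero_le_two,
          ENNReal.ofReal_ofNat, ENNReal.ofReal_ofNat]
        ring
    _ = dominationConst m d C * 2 ^ (j * d) *
          (ENNReal.ofReal (e / 2) * (ENNReal.ofReal (r ^ (m + d)) * U')) := by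
        rw [dominationConst]
        ring
    _ ≤ _ := by
        rw [Measure.smul_apply, smul_eq_mul]
        gcongr

/-- The projected Gaussian is dominated by a sum of Gaussians of scales `2⁻ʲ`. -/
theorem projectedGaussian_le_sum [IsFiniteMeasure γ]
    (hK : Measurable fun p : Ω × V => (K p.1).starProjection p.2)
    (hm : ∀ ω, Module.finrank ℝ (K ω) = m) (hV : Module.finrank ℝ V = m + d) (hm0 : m ≠ 0)
    (hC : C ≠ ∞) (hγ : ∀ ξ : V, ‖ξ‖ = 1 → ∀ ρ : ℝ, 0 < ρ →
      γ {ω | Metric.infDist ξ (K ω : Set V) ≤ ρ} ≤ C * ENNReal.ofReal (ρ ^ d)) :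
    projectedGaussian γ K ≤ Measure.sum fun j : ℕ =>
      (dominationConst m d C * 2 ^ (j * d)) • gaussianDensityMeasure V (4 ^ j / 4) := by
  have := isFiniteMeasure_projectedGaussian (γ := γ) (K := K)
  set S : ℕ → Set V := fun j => {x | x ≠ 0 ∧ (‖x‖ ^ d)⁻¹ * Real.exp (-(1 / 2) * ‖x‖ ^ 2) ≤
      (2 ^ d * Real.exp (1 / 4)) * (2 ^ (j * d) * Real.exp (-(4 ^ j / 4) * ‖x‖ ^ 2))}
  set G : ℕ → Measure V := fun j =>
    (dominationConst m d C * 2 ^ (j * d)) • gaussianDensityMeasure V (4 ^ j / 4)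
  have hG : ∀ j, IsFiniteMeasure (G j) := fun j => by
    have := isFiniteMeasure_gaussianDensityMeasure (V := V) (a := 4 ^ j / 4) (by positivity)
    refine Measure.smul_finite _ ?_
    exact ENNReal.mul_ne_top (dominationConst_ne_top m d hC) (by finiteness)
  -- Differentiation of measures: an inequality on small balls centred at the points of a set
  -- integrates to an inequality on that set.
  have hloc : ∀ j A, projectedGaussian γ K (A ∩ S j) ≤ G j (A ∩ S j) := by
    intro j A
    refine (Besicovitch.vitaliFamily (projectedGaussian γ K)).measure_le_of_frequently_le (G j)
      Measure.AbsolutelyContinuous.rfl _ fun x hx => ?_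
    refine (Besicovitch.tendsto_filterAt (projectedGaussian γ K) x).frequently ?_
    exact (eventually_projectedGaussian_closedBall_le hK hm hV hγ hx.2.1 hx.2.2).frequently
  refine Measure.le_iff.2 fun A hA => ?_
  have hcover : A ⊆ {0} ∪ ⋃ j, A ∩ S j := by
    intro x hx
    by_cases h0 : x = 0
    · exact Or.inl h0
    · obtain ⟨j, hj⟩ := exists_rpow_neg_mul_exp_le d (norm_pos_iff.2 h0)
      exact Or.inr (mem_iUnion.2 ⟨j, hx, h0, hj⟩)
  calc projectedGaussian γ K A
      ≤ projectedGaussian γ K {0} + projectedGaussian γ K (⋃ j, A ∩ S j) :=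
        (measure_mono hcover).trans (measure_union_le _ _)
    _ ≤ 0 + ∑' j, projectedGaussian γ K (A ∩ S j) := by
        rw [projectedGaussian_singleton_zero hK hm hV hm0]
        gcongr
        exact measure_iUnion_le _
    _ ≤ ∑' j, G j A := by
        rw [zero_add]
        exact ENNReal.tsum_le_tsum fun j =>
          (hloc j A).trans (measure_mono inter_subset_left)
    _ = _ := (Measure.sum_apply _ hA).symm

end ProjectedGaussian

/-! ### Averaged energies of projections. -/

section ProjectedEnergy

variable {V : Type*} [NormedAddCommGroup V] [InnerProductSpace ℝ V] [FiniteDimensional ℝ V]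
  [MeasurableSpace V] [BorelSpace V] {Ω : Type*} [MeasurableSpace Ω]
  {γ : Measure Ω} [IsFiniteMeasure γ] {K : Ω → Submodule ℝ V} {m d : ℕ} {C : ℝ≥0∞}

open scoped RealInnerProductSpace

/-- For fixed `ω` self-adjointness moves the projection onto `t`, leaving the Gaussian transform at
the projection of `t`. The result is real and nonnegative, so it can serve as an energy kernel. -/
theorem charFun_projectedGaussian
    (hK : Measurable fun p : Ω × V => (K p.1).starProjection p.2) (t : V) :
    charFun (projectedGaussian γ K) t =
      (((Real.pi / (1 / 2)) ^ (Module.finrank ℝ V / 2 : ℝ) *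
        ∫ ω, Real.exp (-(‖(K ω).starProjection t‖ ^ 2 / 2)) ∂γ : ℝ) : ℂ) := by
  have := isFiniteMeasure_gaussianDensityMeasure (V := V) (a := 1 / 2) (by norm_num)
  have hc : Continuous fun x : V => Complex.exp (⟪x, t⟫ * Complex.I) := by fun_prop
  have hint : Integrable (fun p : Ω × V =>
      Complex.exp (⟪(K p.1).starProjection p.2, t⟫ * Complex.I))
      (γ.prod (gaussianDensityMeasure V (1 / 2))) := by
    refine Integrable.of_bound (C := 1) (hc.measurable.comp hK).aestronglyMeasurable ?_
    exact Eventually.of_forall fun p => by simp [Complex.norm_exp]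
  rw [charFun_apply, projectedGaussian, integral_map hK.aemeasurable hc.aestronglyMeasurable,
    integral_prod _ hint, Complex.ofReal_mul, ← integral_complex_ofReal, ← integral_const_mul]
  refine integral_congr_ae (Eventually.of_forall fun ω => ?_)
  simp only [Submodule.inner_starProjection_left_eq_right]
  refine (charFun_apply ((K ω).starProjection t)).symm.trans ?_
  rw [charFun_gaussianDensityMeasure (by norm_num), Complex.ofReal_mul]
  norm_num

theorem ofReal_integral_exp_eq_lintegral
    (hK : Measurable fun p : Ω × V => (K p.1).starProjection p.2) (t : V) :
    ENNReal.ofReal (∫ ω, Real.exp (-(‖(K ω).starProjection t‖ ^ 2 / 2)) ∂γ) =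
      ∫⁻ ω, ENNReal.ofReal (Real.exp (-(‖(K ω).starProjection t‖ ^ 2 / 2))) ∂γ := by
  have hm : Measurable ((fun p : Ω × V => (K p.1).starProjection p.2) ∘ fun ω => (ω, t)) :=
    hK.comp measurable_prodMk_right
  change Measurable fun ω => (K ω).starProjection t at hm
  refine ofReal_integral_eq_lintegral_ofReal ?_ (Eventually.of_forall fun ω => (Real.exp_pos _).le)
  refine Integrable.of_bound (C := 1)
    (by exact (((hm.norm.pow_const 2).div_const 2).neg.exp).aestronglyMeasurable) ?_
  refine Eventually.of_forall fun ω => ?_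
  rw [Real.norm_of_nonneg (Real.exp_pos _).le, Real.exp_le_one_iff]
  have := sq_nonneg ‖(K ω).starProjection t‖
  linarith

/-- The height `2 ^ (j * d)` of the `j`-th dominating Gaussian against its total mass, of order `2 ^
(-j * (m + d))`, leaves the weight `2 ^ (-j * m)`. -/
theorem inv_two_pow_mul_eq (m d j : ℕ) :
    (2 : ℝ≥0∞) ^ (j * d) * ENNReal.ofReal ((Real.pi / (4 ^ j / 4)) ^ (((m + d : ℕ) : ℝ) / 2)) =
      ENNReal.ofReal ((Real.pi * 4) ^ (((m + d : ℕ) : ℝ) / 2)) * 2⁻¹ ^ (j * m) := by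
  have h1 : (Real.pi / (4 ^ j / 4)) ^ (((m + d : ℕ) : ℝ) / 2) =
      (Real.pi * 4) ^ (((m + d : ℕ) : ℝ) / 2) * (2 ^ (j * (m + d)))⁻¹ := by
    have h2 : Real.pi / (4 ^ j / 4) = Real.pi * 4 * ((2 ^ j)⁻¹) ^ 2 := by
      rw [inv_pow, ← pow_mul, mul_comm j 2, pow_mul]
      norm_num
      field_simp
    have h3 : (((2 : ℝ) ^ j)⁻¹ ^ 2) ^ (((m + d : ℕ) : ℝ) / 2) = ((2 ^ j)⁻¹) ^ (m + d) := by
      rw [← Real.rpow_natCast _ 2, ← Real.rpow_mul (by positivity),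
        ← Real.rpow_natCast _ (m + d)]
      congr 1
      push_cast
      ring
    rw [h2, Real.mul_rpow (by positivity) (by positivity), h3, pow_mul, inv_pow]
  rw [h1, ENNReal.ofReal_mul (by positivity), ENNReal.ofReal_inv_of_pos (by positivity),
    ENNReal.ofReal_pow zero_le_two, ENNReal.ofReal_ofNat, mul_add, pow_add,
    ENNReal.mul_inv (by simp) (by simp), mul_left_comm, mul_comm (((2 : ℝ≥0∞) ^ (j * m))⁻¹),
    ← mul_assoc (2 ^ (j * d)), ENNReal.mul_inv_cancel (by simp) (by simp), one_mul,
    ENNReal.inv_pow]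

/-- The Gaussian energies of the projections are bounded, on average, by a weighted sum of
Gaussian energies. -/
theorem exists_lintegral_projected_energy_le
    (hK : Measurable fun p : Ω × V => (K p.1).starProjection p.2)
    (hm : ∀ ω, Module.finrank ℝ (K ω) = m) (hV : Module.finrank ℝ V = m + d) (hm0 : m ≠ 0)
    (hC : C ≠ ∞) (hγ : ∀ ξ : V, ‖ξ‖ = 1 → ∀ ρ : ℝ, 0 < ρ →
      γ {ω | Metric.infDist ξ (K ω : Set V) ≤ ρ} ≤ C * ENNReal.ofReal (ρ ^ d)) :
    ∃ A : ℝ≥0∞, A ≠ ∞ ∧ ∀ (μ : Measure V) [IsFiniteMeasure μ],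
      ∫⁻ ω, ∫⁻ x, ∫⁻ y,
        ENNReal.ofReal (Real.exp (-(‖(K ω).starProjection (x - y)‖ ^ 2 / 2))) ∂μ ∂μ ∂γ ≤
      A * ∑' j : ℕ, 2⁻¹ ^ (j * m) *
        ∫⁻ x, ∫⁻ y, ENNReal.ofReal (Real.exp (-(‖x - y‖ ^ 2 / 4 ^ j))) ∂μ ∂μ := by
  set B := ENNReal.ofReal ((Real.pi / (1 / 2)) ^ (Module.finrank ℝ V / 2 : ℝ)) with hB
  set B' := ENNReal.ofReal ((Real.pi * 4) ^ (((m + d : ℕ) : ℝ) / 2)) with hB'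
  have hB0 : B ≠ 0 := by
    rw [hB, ne_eq, ENNReal.ofReal_eq_zero, not_le]
    positivity
  have hBt : B ≠ ∞ := ENNReal.ofReal_ne_top
  refine ⟨B⁻¹ * (dominationConst m d C * B'), ENNReal.mul_ne_top (ENNReal.inv_ne_top.2 hB0)
    (ENNReal.mul_ne_top (dominationConst_ne_top m d hC) ENNReal.ofReal_ne_top), ?_⟩
  intro μ _
  have := isFiniteMeasure_projectedGaussian (γ := γ) (K := K)
  have hmeas : Measurable fun p : Ω × V =>
      ENNReal.ofReal (Real.exp (-(‖(K p.1).starProjection p.2‖ ^ 2 / 2))) := by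
    exact ((hK.norm.pow_const 2).div_const 2).neg.exp.ennreal_ofReal
  have hleft : ∫⁻ ξ, ENNReal.ofReal (‖charFun μ ξ‖ ^ 2) ∂projectedGaussian γ K =
      B * ∫⁻ ω, ∫⁻ x, ∫⁻ y,
        ENNReal.ofReal (Real.exp (-(‖(K ω).starProjection (x - y)‖ ^ 2 / 2))) ∂μ ∂μ ∂γ := by
    rw [lintegral_norm_charFun_sq (fun t => by positivity) (charFun_projectedGaussian hK)]
    calc _ = ∫⁻ z, B * ∫⁻ ω, ENNReal.ofReal
          (Real.exp (-(‖(K ω).starProjection z‖ ^ 2 / 2))) ∂γ ∂differenceMeasure μ := by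
          refine lintegral_congr fun z => ?_
          rw [ENNReal.ofReal_mul (by positivity), ofReal_integral_exp_eq_lintegral hK]
      _ = B * ∫⁻ ω, ∫⁻ z, ENNReal.ofReal
          (Real.exp (-(‖(K ω).starProjection z‖ ^ 2 / 2))) ∂differenceMeasure μ ∂γ := by
          rw [lintegral_const_mul' _ _ hBt, lintegral_lintegral_swap]
          exact (hmeas.comp measurable_swap).aemeasurable
      _ = _ := by
          congr 1
          refine lintegral_congr fun ω => ?_
          rw [lintegral_differenceMeasure _ (by fun_prop)]
  have hright : ∀ j : ℕ, ∫⁻ ξ, ENNReal.ofReal (‖charFun μ ξ‖ ^ 2)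
      ∂gaussianDensityMeasure V (4 ^ j / 4) =
      ENNReal.ofReal ((Real.pi / (4 ^ j / 4)) ^ (((m + d : ℕ) : ℝ) / 2)) *
        ∫⁻ x, ∫⁻ y, ENNReal.ofReal (Real.exp (-(‖x - y‖ ^ 2 / 4 ^ j))) ∂μ ∂μ := by
    intro j
    have := isFiniteMeasure_gaussianDensityMeasure (V := V) (a := 4 ^ j / 4) (by positivity)
    rw [lintegral_norm_charFun_sq (fun t => by positivity)
      (charFun_gaussianDensityMeasure (V := V) (a := 4 ^ j / 4) (by positivity)),
      ← lintegral_differenceMeasure _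
        (f := fun z => ENNReal.ofReal (Real.exp (-(‖z‖ ^ 2 / 4 ^ j)))) (by fun_prop),
      ← lintegral_const_mul' _ _ ENNReal.ofReal_ne_top]
    refine lintegral_congr fun z => ?_
    rw [ENNReal.ofReal_mul (by positivity), hV, mul_div_cancel₀ _ (by norm_num)]
  calc _ = B⁻¹ * ∫⁻ ξ, ENNReal.ofReal (‖charFun μ ξ‖ ^ 2) ∂projectedGaussian γ K := by
        rw [hleft, ← mul_assoc, ENNReal.inv_mul_cancel hB0 hBt, one_mul]
    _ ≤ B⁻¹ * ∫⁻ ξ, ENNReal.ofReal (‖charFun μ ξ‖ ^ 2) ∂(Measure.sum fun j : ℕ =>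
          (dominationConst m d C * 2 ^ (j * d)) • gaussianDensityMeasure V (4 ^ j / 4)) := by
        gcongr
        exact projectedGaussian_le_sum hK hm hV hm0 hC hγ
    _ = _ := by
        rw [lintegral_sum_measure, mul_assoc B⁻¹]
        congr 1
        rw [← ENNReal.tsum_mul_left]
        refine tsum_congr fun j => ?_
        rw [lintegral_smul_measure, hright, smul_eq_mul, mul_assoc, ← mul_assoc (2 ^ (j * d)),
          inv_two_pow_mul_eq, mul_assoc, mul_assoc]

/-- The scaled version of `exists_lintegral_projected_energy_le`. -/
theorem exists_lintegral_projected_scaled_energy_le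
    (hK : Measurable fun p : Ω × V => (K p.1).starProjection p.2)
    (hm : ∀ ω, Module.finrank ℝ (K ω) = m) (hV : Module.finrank ℝ V = m + d) (hm0 : m ≠ 0)
    (hC : C ≠ ∞) (hγ : ∀ ξ : V, ‖ξ‖ = 1 → ∀ ρ : ℝ, 0 < ρ →
      γ {ω | Metric.infDist ξ (K ω : Set V) ≤ ρ} ≤ C * ENNReal.ofReal (ρ ^ d)) :
    ∃ A : ℝ≥0∞, A ≠ ∞ ∧ ∀ (μ : Measure V) [IsFiniteMeasure μ] (l : ℝ), 0 < l →
      ∫⁻ ω, ∫⁻ x, ∫⁻ y, ENNReal.ofReal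
        (Real.exp (-((l * ‖(K ω).starProjection (x - y)‖) ^ 2 / 2))) ∂μ ∂μ ∂γ ≤
      A * ∑' j : ℕ, 2⁻¹ ^ (j * m) *
        ∫⁻ x, ∫⁻ y, ENNReal.ofReal (Real.exp (-((l * ‖x - y‖) ^ 2 / 4 ^ j))) ∂μ ∂μ := by
  obtain ⟨A, hA, h⟩ := exists_lintegral_projected_energy_le hK hm hV hm0 hC hγ
  refine ⟨A, hA, fun μ _ l hl => ?_⟩
  have hmap : ∀ f : V → ℝ≥0∞, Measurable f → ∫⁻ x, ∫⁻ y, f (x - y) ∂(μ.map (l • ·)) ∂(μ.map (l • ·))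
      = ∫⁻ x, ∫⁻ y, f (l • (x - y)) ∂μ ∂μ := by
    intro f hf
    rw [lintegral_map (by fun_prop) (by fun_prop)]
    refine lintegral_congr fun x => ?_
    rw [lintegral_map (by fun_prop) (by fun_prop)]
    simp only [smul_sub]
  have hfin : IsFiniteMeasure (μ.map (l • ·)) := Measure.isFiniteMeasure_map _ _
  have h1 := h (μ.map (l • ·))
  have e1 : ∀ ω, ∫⁻ x, ∫⁻ y, ENNReal.ofReal (Real.exp (-(‖(K ω).starProjection (x - y)‖ ^ 2 / 2)))
      ∂(μ.map (l • ·)) ∂(μ.map (l • ·)) = ∫⁻ x, ∫⁻ y, ENNReal.ofReal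
        (Real.exp (-((l * ‖(K ω).starProjection (x - y)‖) ^ 2 / 2))) ∂μ ∂μ := by
    intro ω
    rw [hmap (fun z => ENNReal.ofReal (Real.exp (-(‖(K ω).starProjection z‖ ^ 2 / 2))))
      (by fun_prop)]
    simp only [map_smul, norm_smul, Real.norm_of_nonneg hl.le]
  have e2 : ∀ j : ℕ, ∫⁻ x, ∫⁻ y, ENNReal.ofReal (Real.exp (-(‖x - y‖ ^ 2 / 4 ^ j)))
      ∂(μ.map (l • ·)) ∂(μ.map (l • ·)) = ∫⁻ x, ∫⁻ y, ENNReal.ofReal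
        (Real.exp (-((l * ‖x - y‖) ^ 2 / 4 ^ j))) ∂μ ∂μ := by
    intro j
    rw [hmap (fun z => ENNReal.ofReal (Real.exp (-(‖z‖ ^ 2 / 4 ^ j)))) (by fun_prop)]
    simp only [norm_smul, Real.norm_of_nonneg hl.le]
  simpa only [e1, e2] using h1

end ProjectedEnergy

/-! ### Gaussian potentials of Frostman measures. -/

section FrostmanEnergy

/-- Replaces the Gaussian by dyadic steps of polynomial decay `M + 1`, one more than a bound `M` for
the Frostman exponent, so that the sum over dyadic balls is geometric. -/
theorem exp_neg_sq_le_of_lt_two_pow (M : ℕ) {u : ℝ} (hu : 0 ≤ u) :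
    ∃ k : ℕ, u < 2 ^ k ∧
      Real.exp (-u ^ 2) ≤ (2 ^ (M + 1) * (M + 1).factorial) * (2⁻¹ ^ (k * (M + 1))) := by
  rcases lt_or_ge u 1 with h1 | h1
  · refine ⟨0, by simpa using h1, ?_⟩
    have e1 : Real.exp (-u ^ 2) ≤ 1 := Real.exp_le_one_iff.2 (by nlinarith)
    have e2 : (1 : ℝ) ≤ 2 ^ (M + 1) * (M + 1).factorial :=
      one_le_mul_of_one_le_of_one_le (one_le_pow₀ one_le_two)
        (by exact_mod_cast (M + 1).factorial_pos)
    simpa using e1.trans e2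
  · obtain ⟨j, hj1, hj2⟩ := exists_nat_pow_near h1 one_lt_two
    refine ⟨j + 1, hj2, ?_⟩
    have e1 : u ^ (M + 1) ≤ (M + 1).factorial * Real.exp (u ^ 2) := by
      have h := Real.pow_div_factorial_le_exp u hu (M + 1)
      rw [div_le_iff₀' (by positivity)] at h
      refine h.trans ?_
      gcongr
      nlinarith
    have e2 : (2 : ℝ) ^ ((j + 1) * (M + 1)) ≤ 2 ^ (M + 1) * (M + 1).factorial * Real.exp (u ^ 2) := by
      calc (2 : ℝ) ^ ((j + 1) * (M + 1)) = 2 ^ (M + 1) * (2 ^ j) ^ (M + 1) := by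
            rw [pow_mul, pow_succ 2 j, mul_pow, mul_comm]
        _ ≤ 2 ^ (M + 1) * u ^ (M + 1) := by gcongr
        _ ≤ 2 ^ (M + 1) * ((M + 1).factorial * Real.exp (u ^ 2)) := by gcongr
        _ = _ := by ring
    rw [Real.exp_neg, inv_pow, ← div_eq_mul_inv, le_div_iff₀ (by positivity),
      inv_mul_le_iff₀ (Real.exp_pos _)]
    linarith

variable {V : Type*} [NormedAddCommGroup V] [MeasurableSpace V] [OpensMeasurableSpace V]

/-- Gaussian potentials of a measure with the Frostman growth condition. -/
theorem exists_lintegral_gaussian_le {μ : Measure V} {s : ℝ≥0} {C : ℝ≥0∞} (hC : C ≠ ∞)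
    (hμ : ∀ x r, 0 < r → μ (Metric.ball x r) ≤ C * ENNReal.ofReal r ^ (s : ℝ)) :
    ∃ A : ℝ≥0∞, A ≠ ∞ ∧ ∀ (x : V) (l : ℝ), 0 < l →
      ∫⁻ y, ENNReal.ofReal (Real.exp (-(l * ‖x - y‖) ^ 2)) ∂μ ≤
        A * ENNReal.ofReal l⁻¹ ^ (s : ℝ) := by
  obtain ⟨M, hM⟩ := exists_nat_ge s
  set D : ℝ≥0∞ := 2 ^ (M + 1) * (M + 1).factorial with hD
  have hDt : D ≠ ∞ := by finiteness
  refine ⟨D * (C * (1 - 2⁻¹)⁻¹), ?_, fun x l hl => ?_⟩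
  · refine ENNReal.mul_ne_top hDt (ENNReal.mul_ne_top hC ?_)
    rw [ENNReal.one_sub_inv_two]
    simp
  calc ∫⁻ y, ENNReal.ofReal (Real.exp (-(l * ‖x - y‖) ^ 2)) ∂μ
      ≤ ∫⁻ y, ∑' k : ℕ, (Metric.ball x (2 ^ k * l⁻¹)).indicator
          (fun _ => D * 2⁻¹ ^ (k * (M + 1))) y ∂μ := by
        refine lintegral_mono fun y => ?_
        obtain ⟨k, hk1, hk2⟩ := exp_neg_sq_le_of_lt_two_pow M
          (show 0 ≤ l * ‖x - y‖ by positivity)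
        refine le_trans ?_ (ENNReal.le_tsum k)
        rw [indicator_of_mem]
        · refine (ENNReal.ofReal_le_ofReal hk2).trans_eq ?_
          rw [ENNReal.ofReal_mul (by positivity), ENNReal.ofReal_mul (by positivity),
            ENNReal.ofReal_pow (by positivity), ENNReal.ofReal_pow (by positivity),
            ENNReal.ofReal_inv_of_pos (by positivity), ENNReal.ofReal_natCast,
            ENNReal.ofReal_ofNat]
        · rw [Metric.mem_ball, dist_comm, dist_eq_norm, ← div_eq_mul_inv, lt_div_iff₀ hl]
          linarith
    _ = ∑' k : ℕ, D * 2⁻¹ ^ (k * (M + 1)) * μ (Metric.ball x (2 ^ k * l⁻¹)) := by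
        rw [lintegral_tsum fun k => (measurable_const.indicator measurableSet_ball).aemeasurable]
        exact tsum_congr fun k => lintegral_indicator_const measurableSet_ball _
    _ ≤ ∑' k : ℕ, D * (C * 2⁻¹ ^ k) * ENNReal.ofReal l⁻¹ ^ (s : ℝ) := by
        refine ENNReal.tsum_le_tsum fun k => ?_
        have e1 : ((2 : ℝ≥0∞) ^ k) ^ (s : ℝ) ≤ 2 ^ (k * M) := by
          rw [pow_mul, ← ENNReal.rpow_natCast _ M]
          exact ENNReal.rpow_le_rpow_of_exponent_le (one_le_pow₀ (by norm_num))
            (by exact_mod_cast hM)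
        calc D * 2⁻¹ ^ (k * (M + 1)) * μ (Metric.ball x (2 ^ k * l⁻¹))
            ≤ D * 2⁻¹ ^ (k * (M + 1)) * (C * ENNReal.ofReal (2 ^ k * l⁻¹) ^ (s : ℝ)) := by
              gcongr
              exact hμ x _ (by positivity)
          _ = D * 2⁻¹ ^ (k * (M + 1)) *
                (C * ((2 ^ k) ^ (s : ℝ) * ENNReal.ofReal l⁻¹ ^ (s : ℝ))) := by
              rw [ENNReal.ofReal_mul (by positivity), ENNReal.ofReal_pow zero_le_two,
                ENNReal.ofReal_ofNat, ENNReal.mul_rpow_of_nonneg _ _ s.coe_nonneg]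
          _ ≤ D * 2⁻¹ ^ (k * (M + 1)) *
                (C * (2 ^ (k * M) * ENNReal.ofReal l⁻¹ ^ (s : ℝ))) := by gcongr
          _ = D * (C * (2⁻¹ ^ k * (2⁻¹ * 2) ^ (k * M))) * ENNReal.ofReal l⁻¹ ^ (s : ℝ) := by
              rw [mul_pow, mul_add, pow_add]
              ring
          _ = _ := by
              rw [ENNReal.inv_mul_cancel two_ne_zero ENNReal.ofNat_ne_top, one_pow, mul_one]
    _ = _ := by
        rw [ENNReal.tsum_mul_right, ENNReal.tsum_mul_left, ENNReal.tsum_mul_left,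
          ENNReal.tsum_geometric]

theorem tsum_le_of_le_geometric {a : ℕ → ℝ≥0∞} {B q : ℝ≥0∞} (k : ℕ)
    (h1 : ∀ j < k, a j ≤ B * q ^ (k - j)) (h2 : ∀ j ≥ k, a j ≤ B * q ^ (j - k)) :
    ∑' j, a j ≤ 2 * B * (1 - q)⁻¹ := by
  rw [← Summable.sum_add_tsum_nat_add' (k := k) (f := a) ENNReal.summable, two_mul, add_mul]
  gcongr
  · calc ∑ j ∈ Finset.range k, a j ≤ ∑ j ∈ Finset.range k, B * q ^ (k - j) :=
          Finset.sum_le_sum fun j hj => h1 j (Finset.mem_range.1 hj)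
      _ = ∑ j ∈ Finset.range k, B * q ^ (j + 1) := by
          rw [← Finset.sum_range_reflect]
          refine Finset.sum_congr rfl fun j hj => ?_
          rw [Finset.mem_range] at hj
          congr 2
          omega
      _ ≤ ∑' j, B * q ^ (j + 1) := ENNReal.sum_le_tsum _
      _ ≤ ∑' j, B * q ^ j := by
          rw [ENNReal.tsum_mul_left, ENNReal.tsum_mul_left]
          gcongr B * ?_
          exact ENNReal.tsum_comp_le_tsum_of_injective (add_left_injective 1) fun j => q ^ j
      _ = _ := by rw [ENNReal.tsum_mul_left, ENNReal.tsum_geometric]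
  · calc ∑' j, a (j + k) ≤ ∑' j, B * q ^ j := by
          refine ENNReal.tsum_le_tsum fun j => ?_
          simpa using h2 (j + k) (Nat.le_add_left k j)
      _ = _ := by rw [ENNReal.tsum_mul_left, ENNReal.tsum_geometric]

end FrostmanEnergy

/-! ### Decay of the averaged energy at small scales. -/

section EnergyDecay

variable {V : Type*} [NormedAddCommGroup V] [InnerProductSpace ℝ V] [FiniteDimensional ℝ V]
  [MeasurableSpace V] [BorelSpace V] {Ω : Type*} [MeasurableSpace Ω]
  {γ : Measure Ω} [IsFiniteMeasure γ] {K : Ω → Submodule ℝ V} {m d : ℕ} {C : ℝ≥0∞}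

theorem inv_two_pow_le_one (i : ℕ) : (2 : ℝ≥0∞)⁻¹ ^ i ≤ 1 := pow_le_one₀ zero_le (by simp)

/-- The `j`-th term of the scaled energy bound is at most a constant times `2 ^ (-j t - (k - j) s)`
for `j < k`, by the Frostman condition, and at most `2 ^ (-j t)` for `j ≥ k`, trivially. Both equal
`2 ^ (-k t)` at `j = k` and fall off geometrically on either side, at rates `s - t` and `t`. -/
theorem exists_projected_energy_decay
    (hK : Measurable fun p : Ω × V => (K p.1).starProjection p.2)
    (hm : ∀ ω, Module.finrank ℝ (K ω) = m) (hV : Module.finrank ℝ V = m + d) (hm0 : m ≠ 0)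
    (hC : C ≠ ∞) (hγ : ∀ ξ : V, ‖ξ‖ = 1 → ∀ ρ : ℝ, 0 < ρ →
      γ {ω | Metric.infDist ξ (K ω : Set V) ≤ ρ} ≤ C * ENNReal.ofReal (ρ ^ d))
    {μ : Measure V} [IsProbabilityMeasure μ] {s : ℝ≥0} {C' : ℝ≥0∞} (hC' : C' ≠ ∞)
    (hμ : ∀ x r, 0 < r → μ (Metric.ball x r) ≤ C' * ENNReal.ofReal r ^ (s : ℝ))
    {t : ℝ} (ht0 : 0 < t) (hts : t < s) (htm : t ≤ m) :
    ∃ A : ℝ≥0∞, A ≠ ∞ ∧ ∀ k : ℕ, ∫⁻ ω, ∫⁻ x, ∫⁻ y, ENNReal.ofReal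
        (Real.exp (-((2 ^ k * ‖(K ω).starProjection (x - y)‖) ^ 2 / 2))) ∂μ ∂μ ∂γ ≤
      A * (2⁻¹ ^ k) ^ t := by
  obtain ⟨A, hA, hAμ⟩ := exists_lintegral_projected_scaled_energy_le hK hm hV hm0 hC hγ
  obtain ⟨A', hA', hA'μ⟩ := exists_lintegral_gaussian_le hC' hμ
  set η : ℝ := min t (s - t) with hη
  have hη0 : 0 < η := lt_min ht0 (sub_pos.2 hts)
  set q : ℝ≥0∞ := 2⁻¹ ^ η with hq
  have hq1 : q < 1 := ENNReal.rpow_lt_one (by simp) hη0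
  have hqpow : ∀ i : ℕ, q ^ i = (2⁻¹ ^ i) ^ η := fun i => by
    rw [hq, ← ENNReal.rpow_natCast, ← ENNReal.rpow_mul, mul_comm, ENNReal.rpow_mul,
      ENNReal.rpow_natCast]
  have hfirst : ∀ j : ℕ, (2 : ℝ≥0∞)⁻¹ ^ (j * m) ≤ (2⁻¹ ^ j) ^ t := fun j => by
    rw [pow_mul, ← ENNReal.rpow_natCast _ m]
    exact ENNReal.rpow_le_rpow_of_exponent_ge (inv_two_pow_le_one j) htm
  refine ⟨A * (2 * (A' + 1) * (1 - q)⁻¹), ?_, fun k => ?_⟩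
  · refine ENNReal.mul_ne_top hA (ENNReal.mul_ne_top (by finiteness) (ENNReal.inv_ne_top.2 ?_))
    exact (tsub_pos_of_lt hq1).ne'
  refine (hAμ μ (2 ^ k) (by positivity)).trans ?_
  rw [mul_assoc A]
  gcongr A * ?_
  have hsum := tsum_le_of_le_geometric (a := fun j : ℕ => 2⁻¹ ^ (j * m) *
      ∫⁻ x, ∫⁻ y, ENNReal.ofReal (Real.exp (-((2 ^ k * ‖x - y‖) ^ 2 / 4 ^ j))) ∂μ ∂μ)
    (B := (A' + 1) * (2⁻¹ ^ k) ^ t) (q := q) k ?_ ?_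
  · refine hsum.trans_eq ?_
    ring
  · intro j hj
    have hl : (2 : ℝ)⁻¹ ^ (k - j) = (2 ^ k / 2 ^ j)⁻¹ := by
      rw [inv_pow, pow_sub₀ (2 : ℝ) two_ne_zero hj.le, div_eq_mul_inv]
    have hE : ∫⁻ x, ∫⁻ y, ENNReal.ofReal (Real.exp (-((2 ^ k * ‖x - y‖) ^ 2 / 4 ^ j))) ∂μ ∂μ ≤
        A' * (2⁻¹ ^ (k - j)) ^ (s : ℝ) := by
      calc _ ≤ ∫⁻ _x, A' * (2⁻¹ ^ (k - j)) ^ (s : ℝ) ∂μ := by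
            refine lintegral_mono fun x => ?_
            have h := hA'μ x (2 ^ k / 2 ^ j) (by positivity)
            rw [← hl, ENNReal.ofReal_pow (by positivity),
              ENNReal.ofReal_inv_of_pos zero_lt_two, ENNReal.ofReal_ofNat] at h
            refine le_trans (le_of_eq (lintegral_congr fun y => ?_)) h
            congr 3
            rw [show (4 : ℝ) ^ j = (2 ^ j) ^ 2 by
              rw [← pow_mul, mul_comm, pow_mul]; norm_num, ← div_pow, mul_div_right_comm]
        _ = _ := by simp
    have hkj : (2 : ℝ≥0∞)⁻¹ ^ k = 2⁻¹ ^ j * 2⁻¹ ^ (k - j) := by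
      rw [← pow_add, Nat.add_sub_cancel' hj.le]
    have hne0 : (2 : ℝ≥0∞)⁻¹ ^ (k - j) ≠ 0 := (ENNReal.pow_pos (by simp) _).ne'
    have hnet : (2 : ℝ≥0∞)⁻¹ ^ (k - j) ≠ ∞ := ((inv_two_pow_le_one _).trans_lt (by simp)).ne
    calc _ ≤ (2⁻¹ ^ j) ^ t * (A' * (2⁻¹ ^ (k - j)) ^ (s : ℝ)) := by
          gcongr
          exact hfirst j
      _ = A' * (2⁻¹ ^ k) ^ t * (2⁻¹ ^ (k - j)) ^ (s - t : ℝ) := by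
          rw [hkj, ENNReal.mul_rpow_of_nonneg _ _ ht0.le, mul_assoc A', mul_assoc ((2⁻¹ ^ j) ^ t),
            ← ENNReal.rpow_add _ _ hne0 hnet, add_sub_cancel]
          ring
      _ ≤ (A' + 1) * (2⁻¹ ^ k) ^ t * q ^ (k - j) := by
          rw [hqpow]
          refine mul_le_mul' (mul_le_mul_left le_self_add _) ?_
          exact ENNReal.rpow_le_rpow_of_exponent_ge (inv_two_pow_le_one _) (min_le_right _ _)
  · intro j hj
    have hE : ∫⁻ x, ∫⁻ y, ENNReal.ofReal (Real.exp (-((2 ^ k * ‖x - y‖) ^ 2 / 4 ^ j))) ∂μ ∂μ ≤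
        1 := by
      calc _ ≤ ∫⁻ _x, ∫⁻ _y, 1 ∂μ ∂μ := by
            refine lintegral_mono fun x => lintegral_mono fun y => ?_
            rw [← ENNReal.ofReal_one]
            refine ENNReal.ofReal_le_ofReal (Real.exp_le_one_iff.2 ?_)
            rw [neg_nonpos]
            positivity
        _ = 1 := by simp
    calc _ ≤ ((2 : ℝ≥0∞)⁻¹ ^ j) ^ t * 1 := by
          gcongr
          exact hfirst j
      _ = 1 * ((2 : ℝ≥0∞)⁻¹ ^ k) ^ t * ((2 : ℝ≥0∞)⁻¹ ^ (j - k)) ^ t := by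
          rw [mul_one, one_mul, ← ENNReal.mul_rpow_of_nonneg _ _ ht0.le, ← pow_add,
            Nat.add_sub_cancel' hj]
      _ ≤ (A' + 1) * (2⁻¹ ^ k) ^ t * q ^ (j - k) := by
          rw [hqpow]
          refine mul_le_mul' (mul_le_mul_left le_add_self _) ?_
          exact ENNReal.rpow_le_rpow_of_exponent_ge (inv_two_pow_le_one _) (min_le_left _ _)

end EnergyDecay

/-! ### The mass distribution principle. -/

section MassDistributionPrinciple

variable {X W : Type*} [MeasurableSpace X] [MetricSpace W] [MeasurableSpace W] [BorelSpace W]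

/-- A measure all of whose dyadic densities of order `t` are finite does not charge the preimage
of a set of zero `t`-dimensional Hausdorff measure. -/
theorem measure_preimage_eq_zero_of_hausdorffMeasure_eq_zero {μ : Measure X} {P : X → W} {t : ℝ}
    (ht : 0 < t) (h : ∀ᵐ x ∂μ, ∃ M : ℕ, ∀ k : ℕ,
      μ {y | dist (P y) (P x) ≤ (2 ^ k)⁻¹} ≤ M * (2⁻¹ ^ k) ^ t)
    {S : Set W} (hS : μH[t] S = 0) : μ (P ⁻¹' S) = 0 := by
  set B : ℕ → Set X := fun M => {x | ∀ k : ℕ,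
    μ {y | dist (P y) (P x) ≤ (2 ^ k)⁻¹} ≤ M * (2⁻¹ ^ k) ^ t}
  have hB : ∀ M, μ (P ⁻¹' S ∩ B M) = 0 := by
    intro M
    -- The factor `2 ^ t` comes from rounding a diameter up to a power of two; the `+ 1` only keeps
    -- `c` nonzero.
    set c : ℝ≥0∞ := M * 2 ^ t + 1 with hc
    have hct : c ≠ ∞ := by
      refine ENNReal.add_ne_top.2 ⟨ENNReal.mul_ne_top (by simp) ?_, by simp⟩
      exact ENNReal.rpow_ne_top_of_nonneg ht.le (by simp)
    have hc0 : c ≠ 0 := by simp [hc]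
    -- Working with outer measures removes any need for `S` or `B M` to be measurable.
    set ν : OuterMeasure W :=
      OuterMeasure.map P (OuterMeasure.restrict (B M) μ.toOuterMeasure) with hν
    have hνapply : ∀ U, ν U = μ (P ⁻¹' U ∩ B M) := fun U => by
      rw [hν, OuterMeasure.map_apply, OuterMeasure.restrict_apply]
      rfl
    have hle : ν ≤ OuterMeasure.mkMetric (c • fun r : ℝ≥0∞ => r ^ t) := by
      refine OuterMeasure.le_mkMetric _ ν 1 one_pos fun U hU => ?_
      rw [hνapply]
      rcases (P ⁻¹' U ∩ B M).eq_empty_or_nonempty with h0 | ⟨x, hxU, hxB⟩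
      · simp [h0]
      have hfin : Metric.ediam U ≠ ∞ := (hU.trans_lt ENNReal.one_lt_top).ne
      have hsub : ∀ k : ℕ, Metric.ediam U ≤ 2⁻¹ ^ k →
          μ (P ⁻¹' U ∩ B M) ≤ M * (2⁻¹ ^ k) ^ t := by
        intro k hk
        refine (measure_mono fun y hy => ?_).trans (hxB k)
        have h1 : edist (P y) (P x) ≤ 2⁻¹ ^ k := 
          (Metric.edist_le_ediam_of_mem (s := U) (show P y ∈ U from hy.1)
            (show P x ∈ U from hxU)).trans hk
        rw [edist_dist, ENNReal.ofReal_le_iff_le_toReal (by finiteness)] at h1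
        simpa using h1
      rcases eq_or_ne (Metric.ediam U) 0 with h0 | h0
      · have hlim : Tendsto (fun k : ℕ => (M : ℝ≥0∞) * (2⁻¹ ^ k) ^ t) atTop (𝓝 0) := by
          have h1 : Tendsto (fun N : ℕ => (2 : ℝ≥0∞)⁻¹ ^ N) atTop (𝓝 0) :=
            ENNReal.tendsto_pow_atTop_nhds_zero_of_lt_one (by simp)
          have h2 := h1.ennrpow_const t
          rw [ENNReal.zero_rpow_of_pos ht] at h2
          simpa using ENNReal.Tendsto.const_mul h2 (Or.inr (ENNReal.natCast_ne_top M))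
        exact (ge_of_tendsto' hlim fun k => hsub k (h0 ▸ zero_le)).trans zero_le
      · have hd0 : 0 < (Metric.ediam U).toReal := ENNReal.toReal_pos h0 hfin
        have hd1 : (Metric.ediam U).toReal ≤ 1 := ENNReal.toReal_mono ENNReal.one_ne_top hU
        obtain ⟨k, hk1, hk2⟩ := exists_nat_pow_near_of_lt_one hd0 hd1
          (show (0 : ℝ) < 2⁻¹ by norm_num) (by norm_num)
        have e1 : Metric.ediam U ≤ 2⁻¹ ^ k := by
          rw [← ENNReal.ofReal_toReal hfin]
          refine (ENNReal.ofReal_le_ofReal hk2).trans_eq ?_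
          rw [ENNReal.ofReal_pow (by norm_num), ENNReal.ofReal_inv_of_pos zero_lt_two,
            ENNReal.ofReal_ofNat]
        have e2 : (2 : ℝ≥0∞)⁻¹ ^ k ≤ 2 * Metric.ediam U := by
          have h3 : (2 : ℝ)⁻¹ ^ k ≤ 2 * (Metric.ediam U).toReal := by
            rw [pow_succ] at hk1
            linarith
          have h4 := ENNReal.ofReal_le_ofReal h3
          rwa [ENNReal.ofReal_pow (by norm_num), ENNReal.ofReal_inv_of_pos zero_lt_two,
            ENNReal.ofReal_mul zero_le_two, ENNReal.ofReal_ofNat, ENNReal.ofReal_toReal hfin] at h4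
        calc μ (P ⁻¹' U ∩ B M) ≤ M * (2⁻¹ ^ k) ^ t := hsub k e1
          _ ≤ M * (2 * Metric.ediam U) ^ t := by gcongr
          _ = M * 2 ^ t * Metric.ediam U ^ t := by
              rw [ENNReal.mul_rpow_of_nonneg _ _ ht.le, mul_assoc]
          _ ≤ c * Metric.ediam U ^ t := by
              gcongr
              exact le_self_add
    have h1 := hle S
    rw [OuterMeasure.mkMetric_smul _ hct hc0, smul_apply,
      OuterMeasure.coe_mkMetric] at h1
    change ν S ≤ c • μH[t] S at h1
    rw [hS, smul_zero, hνapply] at h1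
    exact nonpos_iff_eq_zero.1 h1
  have hcover : P ⁻¹' S ⊆ (⋃ M, P ⁻¹' S ∩ B M) ∪ {x | ¬ ∃ M : ℕ, ∀ k : ℕ,
      μ {y | dist (P y) (P x) ≤ (2 ^ k)⁻¹} ≤ M * (2⁻¹ ^ k) ^ t} := by
    intro x hx
    by_cases hM : ∃ M : ℕ, ∀ k : ℕ, μ {y | dist (P y) (P x) ≤ (2 ^ k)⁻¹} ≤ M * (2⁻¹ ^ k) ^ t
    · obtain ⟨M, hM⟩ := hM
      exact Or.inl (mem_iUnion.2 ⟨M, hx, hM⟩)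
    · exact Or.inr hM
  exact measure_mono_null hcover (measure_union_null (measure_iUnion_null hB) h)

end MassDistributionPrinciple

/-! ### Absolute continuity from finite lower densities. -/

section LowerDensity

variable {X W : Type*} [MeasurableSpace X] [NormedAddCommGroup W] [InnerProductSpace ℝ W]
  [FiniteDimensional ℝ W] [MeasurableSpace W] [BorelSpace W]

/-- A measure with finite lower densities is absolutely continuous. -/
theorem absolutelyContinuous_of_liminf_lt_top {μ : Measure X} [IsFiniteMeasure μ] {P : X → W}
    (hP : Measurable P) {m : ℕ} (hm : Module.finrank ℝ W = m)
    (h : ∀ᵐ x ∂μ, liminf (fun k : ℕ => (2 ^ k) ^ m * μ {y | dist (P y) (P x) ≤ (2 ^ k)⁻¹}) atTop <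
      ∞) : μ.map P ≪ volume := by
  set ν := μ.map P with hν
  have hνfin : IsFiniteMeasure ν := Measure.isFiniteMeasure_map _ _
  refine Measure.AbsolutelyContinuous.mk fun N hN hN0 => ?_
  -- On a Lebesgue-null set the derivative of `volume` with respect to `ν` vanishes `ν`-almost
  -- everywhere, so there the ratio of `ν` to `volume` on small balls tends to infinity, against the
  -- finite `liminf`.
  have h1 : ∀ᵐ p ∂ν, p ∈ N → (volume : Measure W).rnDeriv ν p = 0 := by
    have h2 : ∫⁻ p in N, (volume : Measure W).rnDeriv ν p ∂ν = 0 :=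
      nonpos_iff_eq_zero.1 ((Measure.setLIntegral_rnDeriv_le N).trans_eq hN0)
    rw [lintegral_eq_zero_iff (Measure.measurable_rnDeriv _ _)] at h2
    exact (ae_restrict_iff' hN).1 h2
  have h2 := Besicovitch.ae_tendsto_rnDeriv (volume : Measure W) ν
  have h3 : ∀ᵐ x ∂μ, P x ∉ N := by
    filter_upwards [h, ae_of_ae_map hP.aemeasurable h1, ae_of_ae_map hP.aemeasurable h2]
      with x hx hx1 hx2 hxN
    rw [hx1 hxN] at hx2
    have hseq : Tendsto (fun k : ℕ => ((2 : ℝ) ^ k)⁻¹) atTop (𝓝[>] 0) := by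
      refine tendsto_nhdsWithin_iff.2 ⟨?_, Eventually.of_forall fun k => ?_⟩
      · simpa using tendsto_pow_atTop_nhds_zero_of_lt_one (r := (2 : ℝ)⁻¹) (by norm_num)
          (by norm_num)
      · exact mem_Ioi.2 (by positivity)
    have hlim := hx2.comp hseq
    set c := unitBallVolume m
    have hc0 : c ≠ 0 := unitBallVolume_ne_zero m
    have hct : c ≠ ∞ := unitBallVolume_ne_top m
    have hνball : ∀ k : ℕ, ν (Metric.closedBall (P x) (2 ^ k)⁻¹) =
        μ {y | dist (P y) (P x) ≤ (2 ^ k)⁻¹} := fun k => by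
      rw [hν, Measure.map_apply hP Metric.isClosed_closedBall.measurableSet]
      rfl
    have hinv : Tendsto (fun k : ℕ => ((2 ^ k) ^ m * μ {y | dist (P y) (P x) ≤ (2 ^ k)⁻¹}) / c)
        atTop (𝓝 ∞) := by
      rw [← ENNReal.inv_zero]
      refine (tendsto_inv_iff.2 hlim).congr fun k => ?_
      simp only [Function.comp_apply]
      rw [hνball, volume_closedBall_eq_mul_unitBallVolume _ (by positivity), hm, inv_pow,
        ENNReal.ofReal_inv_of_pos (by positivity), ENNReal.ofReal_pow (by positivity),
        ENNReal.ofReal_pow zero_le_two, ENNReal.ofReal_ofNat,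
        ENNReal.inv_div (Or.inl (measure_ne_top _ _)) (Or.inr (mul_ne_zero (by simp) hc0)),
        div_eq_mul_inv, div_eq_mul_inv, ENNReal.mul_inv (Or.inl (by simp)) (Or.inr hc0), inv_inv]
      ring
    have hmul := ENNReal.Tendsto.mul_const hinv (Or.inl ENNReal.top_ne_zero) (b := c)
    rw [ENNReal.top_mul hc0] at hmul
    have hfin : Tendsto (fun k : ℕ => (2 ^ k) ^ m * μ {y | dist (P y) (P x) ≤ (2 ^ k)⁻¹})
        atTop (𝓝 ∞) := by
      refine hmul.congr fun k => ?_
      rw [ENNReal.div_mul_cancel hc0 hct]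
    rw [hfin.liminf_eq] at hx
    exact hx.ne rfl
  rw [hν, Measure.map_apply hP hN]
  simp only [ae_iff, not_not] at h3
  exact h3

end LowerDensity

/-! ### From energy decay to almost every projection. -/

section ProjectedPotential

theorem ae_ae_lt_top_of_lintegral_ne_top {Ω V : Type*} [MeasurableSpace Ω] [MeasurableSpace V]
    {μ : Measure V} {γ : Measure Ω} [SFinite μ] {H : Ω × V → ℝ≥0∞} (hH : Measurable H)
    (h : ∫⁻ ω, ∫⁻ x, H (ω, x) ∂μ ∂γ ≠ ∞) : ∀ᵐ ω ∂γ, ∀ᵐ x ∂μ, H (ω, x) < ∞ := by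
  filter_upwards [ae_lt_top hH.lintegral_prod_right' h] with ω hω
  exact ae_lt_top (hH.comp measurable_prodMk_left) hω.ne

variable {V : Type*} [NormedAddCommGroup V] [InnerProductSpace ℝ V] [FiniteDimensional ℝ V]
  [MeasurableSpace V] [BorelSpace V] {Ω : Type*}

/-- The Gaussian potential at scale `2⁻ᵏ` of the projection of `μ`. -/
def projectedPotential (K : Ω → Submodule ℝ V) (μ : Measure V) (k : ℕ) (p : Ω × V) : ℝ≥0∞ :=
  ∫⁻ y, ENNReal.ofReal (Real.exp (-((2 ^ k * ‖(K p.1).starProjection (p.2 - y)‖) ^ 2 / 2))) ∂μ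

variable {K : Ω → Submodule ℝ V} {μ : Measure V}

theorem measurable_projectedPotential [MeasurableSpace Ω] [SFinite μ]
    (hK : Measurable fun p : Ω × V => (K p.1).starProjection p.2) (k : ℕ) :
    Measurable (projectedPotential K μ k) := by
  have h1 : Measurable fun p : (Ω × V) × V => (K p.1.1).starProjection (p.1.2 - p.2) := by
    have h2 : Measurable fun p : (Ω × V) × V => (p.1.1, p.1.2 - p.2) := by fun_prop
    exact hK.comp h2
  exact Measurable.lintegral_prod_right'
    (f := fun p : (Ω × V) × V => ENNReal.ofReal
      (Real.exp (-((2 ^ k * ‖(K p.1.1).starProjection (p.1.2 - p.2)‖) ^ 2 / 2))))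
    ((((h1.norm.const_mul _).pow_const 2).div_const 2).neg.exp.ennreal_ofReal)

/-- Markov's inequality: the Gaussian kernel is at least `exp (-1 / 2)` on points whose projections
are within `2⁻ᵏ`. -/
theorem measure_dist_projection_le (k : ℕ) (ω : Ω) (x : V) :
    μ {y | dist ((K ω).orthogonalProjectionOnto y) ((K ω).orthogonalProjectionOnto x) ≤
      (2 ^ k)⁻¹} ≤ ENNReal.ofReal (Real.exp (1 / 2)) * projectedPotential K μ k (ω, x) := by
  set S := {y | dist ((K ω).orthogonalProjectionOnto y) ((K ω).orthogonalProjectionOnto x) ≤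
    (2 ^ k)⁻¹} with hS
  have hSm : MeasurableSet S := (isClosed_le (by fun_prop) continuous_const).measurableSet
  rw [projectedPotential, ← lintegral_const_mul' _ _ ENNReal.ofReal_ne_top,
    ← lintegral_indicator_one hSm]
  refine lintegral_mono fun y => ?_
  by_cases hy : y ∈ S
  · rw [indicator_of_mem hy, Pi.one_apply, ← ENNReal.ofReal_mul (Real.exp_pos _).le,
      ← Real.exp_add, ← ENNReal.ofReal_one]
    refine ENNReal.ofReal_le_ofReal (Real.one_le_exp ?_)
    have h1 : ‖(K ω).starProjection (x - y)‖ ≤ (2 ^ k)⁻¹ := by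
      have h2 : dist ((K ω).orthogonalProjectionOnto y) ((K ω).orthogonalProjectionOnto x) ≤
        (2 ^ k)⁻¹ := hy
      rw [dist_comm, dist_eq_norm, ← map_sub] at h2
      exact h2
    have h3 : 2 ^ k * ‖(K ω).starProjection (x - y)‖ ≤ 1 := by
      calc _ ≤ (2 : ℝ) ^ k * (2 ^ k)⁻¹ := by gcongr
        _ = 1 := mul_inv_cancel₀ (by positivity)
    have h4 : (2 ^ k * ‖(K ω).starProjection (x - y)‖) ^ 2 ≤ 1 := pow_le_one₀ (by positivity) h3
    linarith
  · rw [indicator_of_notMem hy]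
    exact zero_le

variable [MeasurableSpace Ω] {γ : Measure Ω}

/-- Since `t' < t`, the potentials weighted by `2 ^ (k t')` have a summable average. Their sum is
therefore finite almost everywhere and bounds the densities of order `t'` at all scales at once. -/
theorem ae_hausdorffMeasure_image_ne_zero [IsProbabilityMeasure μ]
    (hK : Measurable fun p : Ω × V => (K p.1).starProjection p.2) {A : ℝ≥0∞} (hA : A ≠ ∞)
    {t t' : ℝ} (ht' : 0 < t') (htt' : t' < t)
    (h : ∀ k : ℕ, ∫⁻ ω, ∫⁻ x, projectedPotential K μ k (ω, x) ∂μ ∂γ ≤ A * (2⁻¹ ^ k) ^ t)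
    {E : Set V} (hE : μ Eᶜ = 0) :
    ∀ᵐ ω ∂γ, μH[t'] ((K ω).orthogonalProjectionOnto '' E) ≠ 0 := by
  set H : Ω × V → ℝ≥0∞ := fun p => ∑' k : ℕ, (2 ^ k) ^ t' * projectedPotential K μ k p with hH
  have hHm : Measurable H := Measurable.tsum fun k =>
    (measurable_projectedPotential hK k).const_mul _
  set q : ℝ≥0∞ := 2⁻¹ ^ (t - t') with hq
  have hq1 : q < 1 := ENNReal.rpow_lt_one (by simp) (sub_pos.2 htt')
  have hterm : ∀ k : ℕ, ((2 : ℝ≥0∞) ^ k) ^ t' * (A * (2⁻¹ ^ k) ^ t) = A * q ^ k := by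
    intro k
    have h0 : (2 : ℝ≥0∞)⁻¹ ^ k ≠ 0 := (ENNReal.pow_pos (by simp) _).ne'
    have h1 : (2 : ℝ≥0∞)⁻¹ ^ k ≠ ∞ := ((inv_two_pow_le_one _).trans_lt (by simp)).ne
    have h2 : ((2 : ℝ≥0∞) ^ k) ^ t' = (2⁻¹ ^ k) ^ (-t') := by
      rw [ENNReal.rpow_neg, ← ENNReal.inv_rpow, ENNReal.inv_pow, inv_inv]
    rw [h2, mul_left_comm, ← ENNReal.rpow_add _ _ h0 h1, hq, ← ENNReal.rpow_natCast,
      ← ENNReal.rpow_mul, ← ENNReal.rpow_natCast, ← ENNReal.rpow_mul]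
    congr 2
    ring
  have hint : ∫⁻ ω, ∫⁻ x, H (ω, x) ∂μ ∂γ ≠ ∞ := by
    have h1 : ∫⁻ ω, ∫⁻ x, H (ω, x) ∂μ ∂γ = ∑' k : ℕ, (2 ^ k) ^ t' *
        ∫⁻ ω, ∫⁻ x, projectedPotential K μ k (ω, x) ∂μ ∂γ := by
      have hc : ∀ k : ℕ, ((2 : ℝ≥0∞) ^ k) ^ t' ≠ ∞ := fun k =>
        ENNReal.rpow_ne_top_of_nonneg ht'.le (by finiteness)
      have h2 : ∀ ω, ∫⁻ x, H (ω, x) ∂μ = ∑' k : ℕ, (2 ^ k) ^ t' *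
          ∫⁻ x, projectedPotential K μ k (ω, x) ∂μ := by
        intro ω
        have hmk : ∀ k : ℕ, AEMeasurable
            (fun x => ((2 : ℝ≥0∞) ^ k) ^ t' * projectedPotential K μ k (ω, x)) μ := fun k =>
          (((measurable_projectedPotential hK k).comp
            measurable_prodMk_left).const_mul _).aemeasurable
        simp only [hH]
        rw [lintegral_tsum hmk]
        exact tsum_congr fun k => lintegral_const_mul' _ _ (hc k)
      simp only [h2]
      rw [lintegral_tsum fun k =>
        ((measurable_projectedPotential hK k).lintegral_prod_right'.const_mul _).aemeasurable]
      exact tsum_congr fun k => lintegral_const_mul' _ _ (hc k)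
    rw [h1]
    refine ne_top_of_le_ne_top (b := A * (1 - q)⁻¹)
      (ENNReal.mul_ne_top hA (ENNReal.inv_ne_top.2 (tsub_pos_of_lt hq1).ne')) ?_
    rw [← ENNReal.tsum_geometric, ← ENNReal.tsum_mul_left]
    refine ENNReal.tsum_le_tsum fun k => ?_
    rw [← hterm]
    gcongr
    exact h k
  filter_upwards [ae_ae_lt_top_of_lintegral_ne_top hHm hint] with ω hω hzero
  have hnull : μ ((K ω).orthogonalProjectionOnto ⁻¹'
      ((K ω).orthogonalProjectionOnto '' E)) = 0 := by
    refine measure_preimage_eq_zero_of_hausdorffMeasure_eq_zero ht' ?_ hzero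
    filter_upwards [hω] with x hx
    obtain ⟨M, hM⟩ := ENNReal.exists_nat_gt
      (ENNReal.mul_ne_top (ENNReal.ofReal_ne_top (r := Real.exp (1 / 2))) hx.ne)
    refine ⟨M, fun k => (measure_dist_projection_le k ω x).trans ?_⟩
    have h2 : ((2 : ℝ≥0∞)⁻¹ ^ k) ^ t' * (2 ^ k) ^ t' = 1 := by
      rw [← ENNReal.mul_rpow_of_nonneg _ _ ht'.le, ← mul_pow,
        ENNReal.inv_mul_cancel two_ne_zero ENNReal.ofNat_ne_top, one_pow, ENNReal.one_rpow]
    calc ENNReal.ofReal (Real.exp (1 / 2)) * projectedPotential K μ k (ω, x)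
        = ENNReal.ofReal (Real.exp (1 / 2)) *
          ((2 ^ k) ^ t' * projectedPotential K μ k (ω, x)) * (2⁻¹ ^ k) ^ t' := by
          symm
          calc _ = ENNReal.ofReal (Real.exp (1 / 2)) * projectedPotential K μ k (ω, x) *
                ((2⁻¹ ^ k) ^ t' * (2 ^ k) ^ t') := by ring
            _ = _ := by rw [h2, mul_one]
      _ ≤ ENNReal.ofReal (Real.exp (1 / 2)) * H (ω, x) * (2⁻¹ ^ k) ^ t' := by
          gcongr
          exact ENNReal.le_tsum k
      _ ≤ M * (2⁻¹ ^ k) ^ t' := by gcongr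
  have hE0 : μ E = 0 := measure_mono_null (subset_preimage_image _ _) hnull
  have : μ univ = 0 := by
    rw [← union_compl_self E]
    exact measure_union_null hE0 hE
  simp at this

/-- At the exact exponent `m` the weighted potentials are only bounded on average and need not be
summable. Fatou's lemma still makes their `liminf` finite almost everywhere, which suffices for
absolute continuity. -/
theorem ae_volume_image_pos [IsProbabilityMeasure μ]
    (hK : Measurable fun p : Ω × V => (K p.1).starProjection p.2) {A : ℝ≥0∞} (hA : A ≠ ∞)
    {m : ℕ} (hm : ∀ ω, Module.finrank ℝ (K ω) = m)
    (h : ∀ k : ℕ, ∫⁻ ω, ∫⁻ x, projectedPotential K μ k (ω, x) ∂μ ∂γ ≤ A * (2⁻¹ ^ k) ^ (m : ℝ))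
    {E : Set V} (hE : μ Eᶜ = 0) :
    ∀ᵐ ω ∂γ, 0 < (volume : Measure (K ω)) ((K ω).orthogonalProjectionOnto '' E) := by
  set F : ℕ → Ω × V → ℝ≥0∞ := fun k p => (2 ^ k) ^ m * projectedPotential K μ k p with hF
  have hFm : ∀ k, Measurable (F k) := fun k => (measurable_projectedPotential hK k).const_mul _
  have hHm : Measurable fun p => liminf (fun k => F k p) atTop := Measurable.liminf hFm
  have hFint : ∀ k, ∫⁻ ω, ∫⁻ x, F k (ω, x) ∂μ ∂γ ≤ A := by
    intro k
    have hc : ((2 : ℝ≥0∞) ^ k) ^ m ≠ ∞ := by finiteness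
    simp only [hF]
    simp_rw [lintegral_const_mul' _ _ hc]
    calc _ ≤ (2 ^ k) ^ m * (A * (2⁻¹ ^ k) ^ (m : ℝ)) := by
          gcongr
          exact h k
      _ = A * ((2⁻¹ * 2) ^ k) ^ m := by
          rw [ENNReal.rpow_natCast, mul_pow, mul_pow]
          ring
      _ = A := by
          rw [ENNReal.inv_mul_cancel two_ne_zero ENNReal.ofNat_ne_top, one_pow, one_pow, mul_one]
  have hint : ∫⁻ ω, ∫⁻ x, liminf (fun k => F k (ω, x)) atTop ∂μ ∂γ ≠ ∞ := by
    refine ne_top_of_le_ne_top hA ?_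
    calc _ ≤ ∫⁻ ω, liminf (fun k => ∫⁻ x, F k (ω, x) ∂μ) atTop ∂γ :=
          lintegral_mono fun ω => lintegral_liminf_le fun k => (hFm k).comp measurable_prodMk_left
      _ ≤ liminf (fun k => ∫⁻ ω, ∫⁻ x, F k (ω, x) ∂μ ∂γ) atTop :=
          lintegral_liminf_le fun k => (hFm k).lintegral_prod_right'
      _ ≤ A := liminf_le_of_frequently_le' (Frequently.of_forall hFint)
  filter_upwards [ae_ae_lt_top_of_lintegral_ne_top hHm hint] with ω hω
  have hac : μ.map (K ω).orthogonalProjectionOnto ≪ (volume : Measure (K ω)) := by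
    refine absolutelyContinuous_of_liminf_lt_top (by fun_prop) (hm ω) ?_
    filter_upwards [hω] with x hx
    have hc : ENNReal.ofReal (Real.exp (1 / 2)) ≠ ∞ := ENNReal.ofReal_ne_top
    refine lt_of_le_of_lt ?_ (ENNReal.mul_lt_top hc.lt_top hx)
    rw [← ENNReal.liminf_const_mul_of_ne_top hc]
    refine liminf_le_liminf (Eventually.of_forall fun k => ?_)
    calc _ ≤ (2 ^ k) ^ m *
            (ENNReal.ofReal (Real.exp (1 / 2)) * projectedPotential K μ k (ω, x)) := by
          gcongr
          exact measure_dist_projection_le k ω x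
      _ = _ := mul_left_comm _ _ _
  rw [pos_iff_ne_zero]
  intro hzero
  -- The image of `E` need not be measurable, hence the inequality `Measure.le_map_apply` in place
  -- of the formula for the image measure.
  have h1 : μ ((K ω).orthogonalProjectionOnto ⁻¹' ((K ω).orthogonalProjectionOnto '' E)) = 0 :=
    nonpos_iff_eq_zero.1 ((Measure.le_map_apply (by fun_prop) _).trans_eq (hac hzero))
  have hE0 : μ E = 0 := measure_mono_null (subset_preimage_image _ _) h1
  have : μ univ = 0 := by
    rw [← union_compl_self E]
    exact measure_union_null hE0 hE
  simp at this

end ProjectedPotential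

/-! ### The Grassmannian and the theorem. -/

namespace Grassmann

variable {n m : ℕ}

theorem measurable_starProjection (G : Set (Grassmann n m)) :
    Measurable fun p : G × EuclideanSpace ℝ (Fin n) => p.1.1.space.starProjection p.2 := by
  have h1 : Continuous (projOp (n := n) (m := m)) :=
    (Isometry.of_dist_eq (f := projOp (n := n) (m := m)) fun _ _ => rfl).continuous
  have h2 : Continuous fun p : G × EuclideanSpace ℝ (Fin n) => projOp p.1.1 p.2 :=
    (h1.comp (continuous_subtype_val.comp continuous_fst)).clm_apply continuous_snd
  exact h2.measurable

theorem dimH_proj_image_le (V : Grassmann n m) (E : Set (EuclideanSpace ℝ (Fin n))) :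
    dimH (V.proj '' E) ≤ dimH E :=
  (V.space.lipschitzWith_orthogonalProjectionOnto).dimH_image_le E

theorem le (V : Grassmann n m) : m ≤ n := by
  have h := Submodule.finrank_le V.1
  rwa [V.2, finrank_euclideanSpace_fin] at h

/-- A Frostman measure on `E` whose projections onto the members of `G` have, on average,
Gaussian energies decaying with exponent `t`. -/
theorem exists_measure_projectedPotential_decay {G : Set (Grassmann n m)} [Nonempty G]
    {γ : Measure G} [IsFiniteMeasure γ] {C : ℝ}
    (hγ : ∀ ξ : EuclideanSpace ℝ (Fin n), ‖ξ‖ = 1 → ∀ ρ : ℝ, 0 < ρ →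
      γ {V : G | Metric.infDist ξ (V.1.space : Set (EuclideanSpace ℝ (Fin n))) ≤ ρ} ≤
        ENNReal.ofReal (C * ρ ^ ((n : ℝ) - (m : ℝ)))) (hm0 : m ≠ 0)
    {E : Set (EuclideanSpace ℝ (Fin n))} (hE : MeasurableSet E) {t s : ℝ≥0} (ht0 : 0 < t)
    (hts : t < s) (hsE : (s : ℝ≥0∞) < dimH E) (htm : t ≤ m) :
    ∃ μ : Measure (EuclideanSpace ℝ (Fin n)), IsProbabilityMeasure μ ∧ μ Eᶜ = 0 ∧
      ∃ A : ℝ≥0∞, A ≠ ∞ ∧ ∀ k : ℕ,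
        ∫⁻ V, ∫⁻ x, projectedPotential (fun V : G => V.1.space) μ k (V, x) ∂μ ∂γ ≤
          A * (2⁻¹ ^ k) ^ (t : ℝ) := by
  obtain ⟨d, hd⟩ := Nat.exists_eq_add_of_le (Classical.arbitrary G).1.le
  obtain ⟨μ, hμ, hμE, C', hC', hball⟩ := exists_frostman_measure (ht0.trans hts) hE hsE
  refine ⟨μ, hμ, hμE, ?_⟩
  refine exists_projected_energy_decay (K := fun V : G => V.1.space)
    (measurable_starProjection G) (fun V => V.1.2) (d := d)
    (by rw [finrank_euclideanSpace_fin, hd]) hm0 (ENNReal.ofReal_ne_top (r := C)) ?_ hC' hball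
    (NNReal.coe_pos.2 ht0) (NNReal.coe_lt_coe.2 hts) (by exact_mod_cast htm)
  intro ξ hξ ρ hρ
  refine (hγ ξ hξ ρ hρ).trans_eq ?_
  have h1 : (n : ℝ) - m = (d : ℕ) := by rw [hd]; push_cast; ring
  rw [h1, Real.rpow_natCast, ENNReal.ofReal_mul' (by positivity)]

end Grassmann

theorem lemma2p2 (n m : ℕ) (G : Set (Grassmann n m)) (γ : Measure G) [IsFiniteMeasure γ]
    (C : ℝ)
    (hγ : ∀ ξ : EuclideanSpace ℝ (Fin n), ‖ξ‖ = 1 → ∀ ρ : ℝ, 0 < ρ →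
      γ {V : G | Metric.infDist ξ (V.1.space : Set (EuclideanSpace ℝ (Fin n))) ≤ ρ} ≤
        ENNReal.ofReal (C * ρ ^ ((n : ℝ) - (m : ℝ)))) :
    IsMMPSpace G γ := by
  rcases isEmpty_or_nonempty G with hG | hG
  · exact ⟨fun E _ _ => Eventually.of_forall fun V => isEmptyElim V,
      fun E _ _ => Eventually.of_forall fun V => isEmptyElim V⟩
  constructor
  · intro E hE hEm
    -- The exceptional null set depends on the threshold, so thresholds are taken rational; a
    -- negative `q` becomes the trivial threshold `0`.
    have hq : ∀ q : ℚ, (Real.toNNReal q : ℝ≥0∞) < dimH E →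
        ∀ᵐ V : G ∂γ, (Real.toNNReal q : ℝ≥0∞) ≤ dimH (V.1.proj '' E) := by
      intro q hqE
      rcases eq_or_ne (Real.toNNReal q) 0 with h0 | h0
      · simp [h0]
      -- The chain is `q < t < s < dimH E`: `s` is the Frostman exponent, `t` the rate of energy
      -- decay, and each gap makes a geometric series converge.
      obtain ⟨t, hqt, htE⟩ := ENNReal.lt_iff_exists_nnreal_btwn.1 hqE
      obtain ⟨s, hts, hsE⟩ := ENNReal.lt_iff_exists_nnreal_btwn.1 htE
      rw [ENNReal.coe_lt_coe] at hqt hts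
      have htm : t ≤ m := by
        have h1 : (t : ℝ≥0∞) ≤ ((m : ℝ≥0) : ℝ≥0∞) := by simpa using htE.le.trans hEm
        exact ENNReal.coe_le_coe.1 h1
      have ht0 : 0 < t := pos_of_gt hqt
      have hm0 : m ≠ 0 := by
        rintro rfl
        simp at htm
        exact ht0.ne' htm
      obtain ⟨μ, hμ, hμE, A, hA, hdecay⟩ :=
        Grassmann.exists_measure_projectedPotential_decay hγ hm0 hE ht0 hts hsE htm
      have hr0 : (0 : ℝ) < (Real.toNNReal q : ℝ≥0) := NNReal.coe_pos.2 (pos_iff_ne_zero.2 h0)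
      have hrt : ((Real.toNNReal q : ℝ≥0) : ℝ) < t := NNReal.coe_lt_coe.2 hqt
      have hpos := ae_hausdorffMeasure_image_ne_zero (K := fun V : G => V.1.space)
        (Grassmann.measurable_starProjection G) hA hr0 hrt hdecay hμE
      filter_upwards [hpos] with V hV
      exact le_dimH_of_hausdorffMeasure_ne_zero hV
    have hall : ∀ᵐ V : G ∂γ, ∀ q : ℚ, (Real.toNNReal q : ℝ≥0∞) < dimH E →
        (Real.toNNReal q : ℝ≥0∞) ≤ dimH (V.1.proj '' E) := by
      refine ae_all_iff.2 fun q => ?_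
      by_cases h : (Real.toNNReal q : ℝ≥0∞) < dimH E
      · filter_upwards [hq q h] with V hV _ using hV
      · exact Eventually.of_forall fun V h' => absurd h' h
    filter_upwards [hall] with V hV
    refine le_antisymm (V.1.dimH_proj_image_le E) (le_of_forall_lt fun a ha => ?_)
    obtain ⟨q, _, haq, hqE⟩ := ENNReal.lt_iff_exists_rat_btwn.1 ha
    exact haq.trans_le (hV q hqE)
  · intro E hE hEm
    -- For `m = 0` the subspace is a single point of positive volume, and only the nonemptiness of
    -- `E` matters.
    rcases eq_or_ne m 0 with rfl | hm0
    · have hne : E.Nonempty := by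
        rw [nonempty_iff_ne_empty]
        rintro rfl
        simp at hEm
      refine Eventually.of_forall fun V => ?_
      have : Subsingleton V.1.space :=
        (Module.finrank_zero_iff (R := ℝ) (M := V.1.space)).1 V.1.2
      rw [((hne.image V.1.proj)).eq_univ]
      exact isOpen_univ.measure_pos _ univ_nonempty
    obtain ⟨s, hms, hsE⟩ := ENNReal.lt_iff_exists_nnreal_btwn.1 hEm
    have hms' : (m : ℝ≥0) < s := by exact_mod_cast hms
    obtain ⟨μ, hμ, hμE, A, hA, hdecay⟩ :=
      Grassmann.exists_measure_projectedPotential_decay hγ hm0 hE (by exact_mod_cast Nat.pos_of_ne_zero hm0) hms' hsE le_rfl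
    exact ae_volume_image_pos (K := fun V : G => V.1.space)
      (Grassmann.measurable_starProjection G) hA (fun V => V.1.2)
      (by simpa using hdecay) hμE

end
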